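/- Let $K$ be a (strict) 2-category. A 1-arrow $j\colon u\to x$ of $K$ is *ff* if post-composition $K(z,u)\to K(z,x)$ with $j$ is fully faithful for every object $z$. Let $\mathsf{J}$ be a class of 1-arrows of $K$ such that: 1. $\mathsf{J}$ contains all identity 1-arrows and is closed under composition; for $j\colon u\to x$ in $\mathsf{J}$ and any $f\colon y\to x$ a strict pullback $y\times_x u$ (in the category underlying $K$) is specified, its projection to $y$ is again in $\mathsf{J}$, and the specified pullback of an identity arrow $\mathrm{id}_x$ along $f\colon y\to x$ is $\mathrm{id}_y$ (with $f$ as the other projection); 2. each $j\colon u\to x$ in $\mathsf{J}$ is strictly 2-regular: for all $f,g\colon x\to y$, every 2-arrow $\tilde a\colon f\circ j\Rightarrow g\circ j$ whose whiskerings with the two projections $u\times_x u\to u$ are equal is the whiskering with $j$ of a unique 2-arrow $a\colon f\Rightarrow g$; 3. each $j$ in $\mathsf{J}$ is ff. Let $K_\mathsf{J}$ be the following bicategory. Its objects are those of $K$. A 1-arrow $x\to y$ is a fraction $(j,f)$, i.e. a span $x\xleftarrow{j}u\xrightarrow{f}y$ with $j\in\mathsf{J}$; a 2-arrow $(j,f)\Rightarrow(k,g)$,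 with $k\colon v\to x$, is a 2-arrow $f\circ\mathrm{pr}_1\Rightarrow g\circ\mathrm{pr}_2\colon u\times_x v\to y$ of $K$. Call *canonical* the unique 2-arrow between two parallel arrows $a,b\colon t\to u$ with $ja=jb$ which $j$ sends to the identity. * The identity 2-arrow of $(j,f)$ is $f$ whiskered with the canonical $\mathrm{pr}_1\Rightarrow\mathrm{pr}_2\colon u\times_xu\to u$. The vertical composite of $t_1\colon(j_1,f_1)\Rightarrow(j_2,f_2)$ and $t_2\colon(j_2,f_2)\Rightarrow(j_3,f_3)$ is the unique 2-arrow on $u_1\times_xu_3$ whose restriction to $u_1\times_xu_2\times_xu_3$ is the composite of the restrictions of $t_1$ and $t_2$. * Fractions are composed by means of the specified pullbacks: $(j,f)$ from $x$ to $y$ followed by $(k,g)$ from $y$ to $z$ (with vertices $u$, $v$) is $x\leftarrow u\times_yv\to z$. The identity fraction is $(\mathrm{id}_x,\mathrm{id}_x)$. * Right whiskering of $t\colon(j_1,f_1)\Rightarrow(j_2,f_2)$ by $(l,h)$, $l\colon w\to y$: restrict $t$ to $(u_1\times_yw)\times_x(u_2\times_yw)$, lift it uniquely through $l$ to a 2-arrow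 between the projections to $w$, and whisker with $h$. * Left whiskering of $t\colon(k_1,g_1)\Rightarrow(k_2,g_2)$ (with vertices $v_1,v_2$ over $y$) by $(j,f)$ from $x$ to $y$ (with vertex $u$): it is the unique 2-arrow on $W=(u\times_yv_1)\times_x(u\times_yv_2)$ whose restriction along $M\times_xW\to W$, where $M=u\times_y(v_1\times_yv_2)$, is the restriction of $t$ along $M\to v_1\times_yv_2$, pre- and post-composed with the whiskered canonical 2-arrows comparing, over $x$, the arrows to $u\times_yv_i$ through $W$ and through $M$. * The associators and unitors are the 2-arrows induced by the canonical comparison arrows $r$ between vertices of iterated fractions, where an arrow $r\colon u\to v$ with $kr=j$, $gr=f$ induces the 2-arrow $(j,f)\Rightarrow(k,g)$ given by $g$ whiskered with the canonical $r\,\mathrm{pr}_1\Rightarrow\mathrm{pr}_2\colon u\times_xv\to v$. (A unitor is the identity whenever its comparison arrow is.) Let $A_\mathsf{J}\colon K\to K_\mathsf{J}$ be the identity on objects, send a 1-arrow $f\colon x\to y$ to the fraction $x\xleftarrow{\mathrm{id}_x}x\xrightarrow{f}y$, and send a 2-arrow $a\colon f\Rightarrow g$ to $a$ itself, regarded as a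 2-arrow on $x\times_xx=x$. Then $A_\mathsf{J}$ is a strict 2-functor: it preserves identity and composite 2-arrows, identity and composite 1-arrows, whiskerings, associators and unitors strictly, its comparison 2-arrows being identities. Moreover it is locally fully faithful: for all objects $x,y$ of $K$ the functor $K(x,y)\to K_\mathsf{J}(x,y)$ is fully faithful. -/

import Mathlib

open CategoryTheory Bicategory

universe w v u

namespace TwoSite

section Basic

variable {K : Type u} [Bicategory.{w, v} K] [Bicategory.Strict K]

/-- A 1-arrow `f : x ⟶ y` of a 2-category is *ff* (representably fully faithful) if postcomposition
`K(z, x) ⥤ K(z, y)` with `f` is fully faithful for every object `z`. -/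
def IsFF {x y : K} (f : x ⟶ y) : Prop :=
  ∀ ⦃z : K⦄ (g h : z ⟶ x) (b : g ≫ f ⟶ h ≫ f), ∃! a : g ⟶ h, a ▷ f = b

/-- A 1-arrow `p : u ⟶ x` with kernel pair `pr₁ pr₂ : e ⟶ u` is *strictly 2-regular* if every
2-arrow `a : p ≫ f ⟶ p ≫ g` whose whiskerings with `pr₁` and `pr₂` agree descends to a unique
2-arrow `f ⟶ g`. -/
def IsStrictlyTwoRegular {e u x : K} (p : u ⟶ x) (pr₁ pr₂ : e ⟶ u)
    (w : pr₁ ≫ p = pr₂ ≫ p) : Prop :=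
  ∀ ⦃y : K⦄ (f g : x ⟶ y) (a : p ≫ f ⟶ p ≫ g),
    pr₁ ◁ a = eqToHom (by rw [← Strict.assoc, w, Strict.assoc]) ≫ pr₂ ◁ a ≫
      eqToHom (by rw [← Strict.assoc, ← w, Strict.assoc]) →
    ∃! b : f ⟶ g, p ◁ b = a

/-- A strict pullback of `j` along `f`, in the category underlying the 2-category. -/
structure StrictPullback {u x y : K} (j : u ⟶ x) (f : y ⟶ x) where
  /-- the vertex -/
  pt : K
  /-- the projection that is the pullback of `j` along `f` -/
  fst : pt ⟶ y
  /-- the other projection -/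
  snd : pt ⟶ u
  isPullback : IsPullback fst snd f j

namespace StrictPullback

/-- The pullback of `𝟙 x` along `f : y ⟶ x` whose first projection is `𝟙 y`. -/
def ofId {x y : K} (f : y ⟶ x) : StrictPullback (𝟙 x) f where
  pt := y
  fst := 𝟙 y
  snd := f
  isPullback := IsPullback.id_horiz f

variable {u x y : K} {j : u ⟶ x} {f : y ⟶ x} (P : StrictPullback j f)

theorem w : P.fst ≫ f = P.snd ≫ j := P.isPullback.w

/-- The arrow into the pullback with given components. -/
noncomputable def lift {T : K} (a : T ⟶ y) (b : T ⟶ u) (h : a ≫ f = b ≫ j) : T ⟶ P.pt :=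
  P.isPullback.lift a b h

@[simp]
theorem lift_fst {T : K} (a : T ⟶ y) (b : T ⟶ u) (h : a ≫ f = b ≫ j) :
    P.lift a b h ≫ P.fst = a := P.isPullback.lift_fst a b h

@[simp]
theorem lift_snd {T : K} (a : T ⟶ y) (b : T ⟶ u) (h : a ≫ f = b ≫ j) :
    P.lift a b h ≫ P.snd = b := P.isPullback.lift_snd a b h

@[simp]
theorem lift_fst_assoc {T z : K} (a : T ⟶ y) (b : T ⟶ u) (h : a ≫ f = b ≫ j) (k : y ⟶ z) :
    P.lift a b h ≫ P.fst ≫ k = a ≫ k := by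
  rw [← Strict.assoc, P.lift_fst]

@[simp]
theorem lift_snd_assoc {T z : K} (a : T ⟶ y) (b : T ⟶ u) (h : a ≫ f = b ≫ j) (k : u ⟶ z) :
    P.lift a b h ≫ P.snd ≫ k = b ≫ k := by
  rw [← Strict.assoc, P.lift_snd]

theorem comp_w {T : K} (r : T ⟶ P.pt) : (r ≫ P.fst) ≫ f = (r ≫ P.snd) ≫ j := by
  rw [Strict.assoc, Strict.assoc, P.w]

theorem comp_lift_snd {R T z : K} (m : R ⟶ T) (a : T ⟶ y) (b : T ⟶ u) (h : a ≫ f = b ≫ j)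
    (k : u ⟶ z) : (m ≫ P.lift a b h) ≫ P.snd ≫ k = (m ≫ b) ≫ k := by
  rw [← Strict.assoc, Strict.assoc m, P.lift_snd]

end StrictPullback

/-- A singleton strict pretopology on a 2-category: a class of 1-arrows containing the identities
and closed under composition, with specified strict pullbacks which again lie in the class, and such
that the specified pullback of an identity 1-arrow is an identity 1-arrow. -/
structure StrictPretopology (K : Type u) [Bicategory.{w, v} K] [Bicategory.Strict K] where
  /-- the class of 1-arrows -/
  mem : ∀ ⦃x y : K⦄, (x ⟶ y) → Prop
  id_mem : ∀ x : K, mem (𝟙 x)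
  comp_mem : ∀ ⦃x y z : K⦄ (f : x ⟶ y) (g : y ⟶ z), mem f → mem g → mem (f ≫ g)
  /-- the specified pullback of `j` along `f` -/
  pullback : ∀ ⦃u x y : K⦄ (j : u ⟶ x) (_ : mem j) (f : y ⟶ x), StrictPullback j f
  pullback_mem : ∀ ⦃u x y : K⦄ (j : u ⟶ x) (hj : mem j) (f : y ⟶ x), mem (pullback j hj f).fst
  pullback_id : ∀ ⦃x y : K⦄ (f : y ⟶ x), pullback (𝟙 x) (id_mem x) f = StrictPullback.ofId f

/-- A strict subcanonical unary 2-site structure all of whose covers are ff: a singleton strict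
pretopology whose members are strictly 2-regular (that is, restriction along each member is fully
faithful into strict descent data) and ff. -/
structure StrictTwoSite (K : Type u) [Bicategory.{w, v} K] [Bicategory.Strict K] extends
    StrictPretopology K where
  subcanonical : ∀ ⦃u x : K⦄ (j : u ⟶ x) (hj : mem j),
    IsStrictlyTwoRegular j (pullback j hj j).fst (pullback j hj j).snd (pullback j hj j).w
  mem_ff : ∀ ⦃u x : K⦄ (j : u ⟶ x), mem j → IsFF j

/-- The unique lift of a 2-arrow through an ff 1-arrow. -/
noncomputable def IsFF.lift {x y z : K} {f : x ⟶ y} (hf : IsFF f) {g h : z ⟶ x}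
    (b : g ≫ f ⟶ h ≫ f) : g ⟶ h := (hf g h b).choose

theorem IsFF.lift_whisker {x y z : K} {f : x ⟶ y} (hf : IsFF f) {g h : z ⟶ x}
    (b : g ≫ f ⟶ h ≫ f) : hf.lift b ▷ f = b := (hf g h b).choose_spec.1

theorem IsFF.lift_eq {x y z : K} {f : x ⟶ y} (hf : IsFF f) {g h : z ⟶ x}
    {b : g ≫ f ⟶ h ≫ f} {a : g ⟶ h} (ha : a ▷ f = b) : hf.lift b = a :=
  ((hf g h b).choose_spec.2 a ha).symm

theorem IsFF.ext {x y z : K} {f : x ⟶ y} (hf : IsFF f) {g h : z ⟶ x}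
    {a a' : g ⟶ h} (ha : a ▷ f = a' ▷ f) : a = a' :=
  (hf g h _).unique ha rfl

/-- Precomposition with an ff and strictly 2-regular arrow is fully faithful. -/
theorem IsStrictlyTwoRegular.existsUnique {e u x y : K} {p : u ⟶ x} {pr₁ pr₂ : e ⟶ u}
    {w : pr₁ ≫ p = pr₂ ≫ p} (h : IsStrictlyTwoRegular p pr₁ pr₂ w) (hp : IsFF p)
    {f g : x ⟶ y} (a : p ≫ f ⟶ p ≫ g) : ∃! b : f ⟶ g, p ◁ b = a := by
  apply h
  obtain ⟨s, hs, -⟩ := hp pr₁ pr₂ (eqToHom w)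
  have e1 := whisker_exchange s a
  rw [whiskerRight_comp, whiskerRight_comp, hs] at e1
  simp only [Strict.associator_eqToIso, eqToIso.hom, eqToIso.inv, eqToHom_whiskerRight,
    eqToHom_trans] at e1
  rw [← Category.assoc (eqToHom _), ← e1]
  simp

namespace StrictTwoSite

variable (S : StrictTwoSite K)

theorem existsUnique_desc {u x y : K} {c : u ⟶ x} (hc : S.mem c) {f g : x ⟶ y}
    (a : c ≫ f ⟶ c ≫ g) : ∃! b : f ⟶ g, c ◁ b = a :=
  (S.subcanonical c hc).existsUnique (S.mem_ff c hc) a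

/-- Unique descent of a 2-arrow along a cover. -/
noncomputable def desc {u x y : K} {c : u ⟶ x} (hc : S.mem c) {f g : x ⟶ y}
    (a : c ≫ f ⟶ c ≫ g) : f ⟶ g := (S.existsUnique_desc hc a).choose

theorem whisker_desc {u x y : K} {c : u ⟶ x} (hc : S.mem c) {f g : x ⟶ y}
    (a : c ≫ f ⟶ c ≫ g) : c ◁ S.desc hc a = a := (S.existsUnique_desc hc a).choose_spec.1

variable {S} in
theorem cover_ext {u x y : K} {c : u ⟶ x} (hc : S.mem c) {f g : x ⟶ y} {a b : f ⟶ g}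
    (h : c ◁ a = c ◁ b) : a = b := (S.existsUnique_desc hc _).unique h rfl

/-- Gluing of a compatible family of local 2-arrows. -/
theorem glue {T y : K} {f g : T ⟶ y} (V : ∀ ⦃R : K⦄ (r : R ⟶ T), (r ≫ f ⟶ r ≫ g) → Prop)
    (uniq : ∀ ⦃R : K⦄ (r : R ⟶ T) (a b), V r a → V r b → a = b)
    (res : ∀ ⦃R R' : K⦄ (k : R' ⟶ R) (r : R ⟶ T) (a), V r a →
      V (k ≫ r) ((α_ k r f).hom ≫ k ◁ a ≫ (α_ k r g).inv))
    (loc : ∃ (R : K) (c : R ⟶ T) (a : _), S.mem c ∧ V c a) :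
    ∃! e : f ⟶ g, ∀ ⦃R : K⦄ (r : R ⟶ T) (a), V r a → r ◁ e = a := by
  obtain ⟨R, c, a, hc, ha⟩ := loc
  obtain ⟨e, he, -⟩ := S.existsUnique_desc hc a
  refine ⟨e, ?_, fun e' he' => cover_ext hc ((he' c a ha).trans he.symm)⟩
  intro R' r b hb
  let P := S.pullback c hc r
  apply cover_ext (S.pullback_mem c hc r)
  have h1 := res P.fst r b hb
  have h2 := res P.snd c a ha
  have key : ∀ (q : P.pt ⟶ T) (_ : P.fst ≫ r = q) (b'), V q b' → b' = q ◁ e := by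
    intro q hq b' hb'
    have hq2 : P.snd ≫ c = q := P.w.symm.trans hq
    subst hq2
    rw [uniq _ _ _ hb' h2, ← he]
    simp
  have h3 := key _ rfl _ h1
  rw [comp_whiskerLeft, cancel_epi, cancel_mono] at h3
  exact h3.symm

end StrictTwoSite

end Basic

section Fractions

variable {K : Type u} [Bicategory.{w, v} K] [Bicategory.Strict K]

/-- A fraction from `x` to `y`: a span `x ⟵ u ⟶ y` whose left leg is a cover. -/
structure Fraction (S : StrictTwoSite K) (x y : K) where
  /-- the vertex of the span -/
  apex : K
  /-- the left leg -/
  left : apex ⟶ x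
  left_mem : S.mem left
  /-- the right leg -/
  right : apex ⟶ y

variable {S : StrictTwoSite K}

namespace Fraction

variable {x y z : K}

theorem left_ff (F : Fraction S x y) : IsFF F.left := S.mem_ff _ F.left_mem

/-- The fraction `x ⟵ x ⟶ y` given by a 1-arrow, with left leg the identity. -/
@[reducible]
def ofArrow (S : StrictTwoSite K) {x y : K} (f : x ⟶ y) : Fraction S x y :=
  ⟨x, 𝟙 x, S.id_mem x, f⟩

/-- The fibre product `u ×ₓ v` of the vertices of two fractions out of `x`. -/
def overlap (F : Fraction S x y) (G : Fraction S x z) : StrictPullback G.left F.left :=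
  S.pullback G.left G.left_mem F.left

/-- The composite span, formed with the specified pullback. -/
@[reducible]
def comp (F : Fraction S x y) (G : Fraction S y z) : Fraction S x z where
  apex := (S.pullback G.left G.left_mem F.right).pt
  left := (S.pullback G.left G.left_mem F.right).fst ≫ F.left
  left_mem := S.comp_mem _ _ (S.pullback_mem _ _ _) F.left_mem
  right := (S.pullback G.left G.left_mem F.right).snd ≫ G.right

/-- A map of fractions from `x ⟵ u ⟶ y` to `x ⟵ v ⟶ y`: a 2-arrow between the two arrows
`u ×ₓ v ⟶ y`. -/
@[ext]
structure Hom (F G : Fraction S x y) where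
  /-- the 2-arrow -/
  cell : (F.overlap G).fst ≫ F.right ⟶ (F.overlap G).snd ≫ G.right

/-- The restriction of a map of fractions along the arrow `T ⟶ u ×ₓ v` with components `a`, `b`. -/
noncomputable def Hom.at {F G : Fraction S x y} (t : Hom F G) {T : K} (a : T ⟶ F.apex)
    (b : T ⟶ G.apex) (h : a ≫ F.left = b ≫ G.left) : a ≫ F.right ⟶ b ≫ G.right :=
  eqToHom (by rw [← Strict.assoc, StrictPullback.lift_fst]) ≫
    (F.overlap G).lift a b h ◁ t.cell ≫
    eqToHom (by rw [← Strict.assoc, StrictPullback.lift_snd])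

/-- The identity map: the canonical 2-arrow `pr₁ ⟶ pr₂ : u ×ₓ u ⟶ u` over `x`, whiskered with the
right leg. -/
noncomputable def Hom.id (F : Fraction S x y) : Hom F F where
  cell := F.left_ff.lift (eqToHom (F.overlap F).w) ▷ F.right

/-- Vertical composition: the 2-arrow `t₁ ⊕ t₂` on `u₁ ×ₓ u₂ ×ₓ u₃`, descended along the projection
to `u₁ ×ₓ u₃`. -/
noncomputable def Hom.comp {F₁ F₂ F₃ : Fraction S x y} (t₁ : Hom F₁ F₂) (t₂ : Hom F₂ F₃) :
    Hom F₁ F₃ where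
  cell :=
    let W := F₁.overlap F₃
    let Q := S.pullback F₂.left F₂.left_mem (W.fst ≫ F₁.left)
    S.desc (S.pullback_mem F₂.left F₂.left_mem (W.fst ≫ F₁.left))
      (eqToHom (Strict.assoc _ _ _).symm ≫
        t₁.at (Q.fst ≫ W.fst) Q.snd (by rw [Strict.assoc, Q.w]) ≫
        t₂.at Q.snd (Q.fst ≫ W.snd) (by rw [Strict.assoc, ← W.w, Q.w]) ≫
        eqToHom (Strict.assoc _ _ _))

/-- The map of fractions associated with a renaming map `(r, a)`. -/
noncomputable def Hom.renaming {F G : Fraction S x y} (r : F.apex ⟶ G.apex)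
    (hr : r ≫ G.left = F.left) (a : F.right ⟶ r ≫ G.right) : Hom F G where
  cell :=
    let W := F.overlap G
    W.fst ◁ a ≫ eqToHom (Strict.assoc _ _ _).symm ≫
      G.left_ff.lift (eqToHom (by rw [Strict.assoc, hr, W.w]) :
        (W.fst ≫ r) ≫ G.left ⟶ W.snd ≫ G.left) ▷ G.right

/-- Right whiskering of a map of fractions `t : F ⟶ G` by `H`. The source of the 2-arrow is the
fibre product of the vertices of `F.comp H` and `G.comp H`; the 2-arrow is the unique lift of the
restriction of `t` through the left leg of `H`, whiskered with the right leg of `H`. -/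
noncomputable def Hom.whiskerRight {F G : Fraction S x y} (t : Hom F G) (H : Fraction S y z) :
    Hom (F.comp H) (G.comp H) where
  cell :=
    let A := S.pullback H.left H.left_mem F.right
    let B := S.pullback H.left H.left_mem G.right
    let W : StrictPullback (B.fst ≫ G.left) (A.fst ≫ F.left) := (F.comp H).overlap (G.comp H)
    eqToHom (Strict.assoc _ _ _).symm ≫
      H.left_ff.lift
        (eqToHom (A.comp_w _).symm ≫
          t.at (W.fst ≫ A.fst) (W.snd ≫ B.fst) (by rw [Strict.assoc, W.w, Strict.assoc]) ≫
          eqToHom (B.comp_w _) :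
        (W.fst ≫ A.snd) ≫ H.left ⟶ (W.snd ≫ B.snd) ≫ H.left) ▷ H.right ≫
      eqToHom (Strict.assoc _ _ _)

/-- Left whiskering of a map of fractions `t : G ⟶ H` by `F = (x ⟵ u ⟶ y)`. Write `v₁`, `v₂` for
the vertices of `G`, `H`, let `W = (u ×_y v₁) ×ₓ (u ×_y v₂)` and `M = u ×_y (v₁ ×_y v₂)`. The
2-arrow on `W` is descended along the projection `C = M ×ₓ W ⟶ W` from the composite of
the canonical 2-arrow over `x` from `C ⟶ W ⟶ u ×_y v₁` to `C ⟶ M ⟶ u ×_y v₁`, the restriction of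
`t` along `C ⟶ M ⟶ v₁ ×_y v₂`, and the canonical 2-arrow over `x` from `C ⟶ M ⟶ u ×_y v₂` to
`C ⟶ W ⟶ u ×_y v₂`. -/
noncomputable def Hom.whiskerLeft (F : Fraction S x y) {G H : Fraction S y z} (t : Hom G H) :
    Hom (F.comp G) (F.comp H) where
  cell :=
    let A := S.pullback G.left G.left_mem F.right
    let B := S.pullback H.left H.left_mem F.right
    let W : StrictPullback (B.fst ≫ F.left) (A.fst ≫ F.left) := (F.comp G).overlap (F.comp H)
    let N := G.overlap H
    have hN : S.mem (N.fst ≫ G.left) := S.comp_mem _ _ (S.pullback_mem _ _ _) G.left_mem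
    let M := S.pullback (N.fst ≫ G.left) hN F.right
    have hM : S.mem (M.fst ≫ F.left) := S.comp_mem _ _ (S.pullback_mem _ _ _) F.left_mem
    let C := S.pullback (M.fst ≫ F.left) hM (W.fst ≫ A.fst ≫ F.left)
    let mA : M.pt ⟶ A.pt := A.lift M.fst (M.snd ≫ N.fst) (by rw [M.w, Strict.assoc])
    let mB : M.pt ⟶ B.pt := B.lift M.fst (M.snd ≫ N.snd)
      (by rw [M.w, Strict.assoc, ← N.w])
    let sA : C.fst ≫ W.fst ⟶ C.snd ≫ mA := (F.comp G).left_ff.lift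
      (eqToHom (by
        change (C.fst ≫ W.fst) ≫ A.fst ≫ F.left = (C.snd ≫ mA) ≫ A.fst ≫ F.left
        rw [Strict.assoc, C.w, Strict.assoc, ← Strict.assoc mA, A.lift_fst]))
    let sB : C.snd ≫ mB ⟶ C.fst ≫ W.snd := (F.comp H).left_ff.lift
      (eqToHom (by
        change (C.snd ≫ mB) ≫ B.fst ≫ F.left = (C.fst ≫ W.snd) ≫ B.fst ≫ F.left
        rw [Strict.assoc, Strict.assoc, ← W.w, C.w, ← Strict.assoc mB, B.lift_fst]))
    S.desc (S.pullback_mem _ hM (W.fst ≫ A.fst ≫ F.left))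
      (eqToHom (Strict.assoc _ _ _).symm ≫ sA ▷ (A.snd ≫ G.right) ≫
        eqToHom (A.comp_lift_snd _ _ _ _ _) ≫
        t.at (C.snd ≫ M.snd ≫ N.fst) (C.snd ≫ M.snd ≫ N.snd)
          (by simp only [Strict.assoc, N.w]) ≫
        eqToHom (B.comp_lift_snd _ _ _ _ _).symm ≫
        sB ▷ (B.snd ≫ H.right) ≫ eqToHom (Strict.assoc _ _ _))

end Fraction

end Fractions

section Calculus

variable {K : Type u} [Bicategory.{w, v} K] [Bicategory.Strict K] {S : StrictTwoSite K}

attribute [local simp] Strict.associator_eqToIso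

namespace Fraction

variable {x y z : K}

/-- `a : T ⟶ u` is a generalised element of a fraction `x ⟵ u ⟶ y`, with images `p` and `q` in `x`
and `y`. -/
structure Pt (F : Fraction S x y) {T : K} (a : T ⟶ F.apex) (p : T ⟶ x) (q : T ⟶ y) : Prop where
  hb : a ≫ F.left = p
  ho : a ≫ F.right = q

namespace Pt

variable {F : Fraction S x y} {T R : K} {a a' a'' : T ⟶ F.apex} {p p' p'' : T ⟶ x}
  {q q' q'' : T ⟶ y}

/-- Restriction of an element. -/
theorem res (r : R ⟶ T) (P : F.Pt a p q) : F.Pt (r ≫ a) (r ≫ p) (r ≫ q) where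
  hb := by rw [Strict.assoc, P.hb]
  ho := by rw [Strict.assoc, P.ho]

/-- The action of a 2-arrow in the base on elements. -/
noncomputable def move (P : F.Pt a p q) (Q : F.Pt a' p' q') (θ : p ⟶ p') : q ⟶ q' :=
  eqToHom P.ho.symm ≫ F.left_ff.lift (eqToHom P.hb ≫ θ ≫ eqToHom Q.hb.symm) ▷ F.right ≫
    eqToHom Q.ho

theorem move_eq {P : F.Pt a p q} {Q : F.Pt a' p' q'} {θ : p ⟶ p'} (s : a ⟶ a')
    (h : s ▷ F.left = eqToHom P.hb ≫ θ ≫ eqToHom Q.hb.symm) :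
    P.move Q θ = eqToHom P.ho.symm ≫ s ▷ F.right ≫ eqToHom Q.ho := by
  rw [move, F.left_ff.lift_eq h]

theorem exists_lift (P : F.Pt a p q) (Q : F.Pt a' p' q') (θ : p ⟶ p') : ∃ s : a ⟶ a',
    s ▷ F.left = eqToHom P.hb ≫ θ ≫ eqToHom Q.hb.symm := ⟨_, F.left_ff.lift_whisker _⟩

@[simp]
theorem move_id (P : F.Pt a p q) (Q : F.Pt a p q) : P.move Q (𝟙 _) = 𝟙 _ := by
  rw [move_eq (𝟙 _)] <;> simp

@[simp]
theorem move_move (P : F.Pt a p q) (Q : F.Pt a' p' q') (Q' : F.Pt a' p' q')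
    (R : F.Pt a'' p'' q'') (θ : p ⟶ p')
    (θ' : p' ⟶ p'') : P.move Q θ ≫ Q'.move R θ' = P.move R (θ ≫ θ') := by
  obtain ⟨s, hs⟩ := exists_lift P Q θ
  obtain ⟨s', hs'⟩ := exists_lift Q R θ'
  rw [move_eq s hs, move_eq s' hs', move_eq (s ≫ s') (by simp [hs, hs'])]
  simp

@[simp]
theorem move_move_assoc (P : F.Pt a p q) (Q : F.Pt a' p' q') (Q' : F.Pt a' p' q')
    (R : F.Pt a'' p'' q'') (θ : p ⟶ p') (θ' : p' ⟶ p'') {s : T ⟶ y} (e : q'' ⟶ s) :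
    P.move Q θ ≫ Q'.move R θ' ≫ e = P.move R (θ ≫ θ') ≫ e := by
  rw [← Category.assoc, move_move]

theorem res_move (r : R ⟶ T) (P : F.Pt a p q) (Q : F.Pt a' p' q') (θ : p ⟶ p') :
    r ◁ P.move Q θ = (P.res r).move (Q.res r) (r ◁ θ) := by
  obtain ⟨s, hs⟩ := exists_lift P Q θ
  rw [move_eq s hs, move_eq (r ◁ s) (by simp [hs])]
  simp

/-- Two restrictions of an element along 2-isomorphic arrows. -/
theorem whiskerRight_out {r r' : R ⟶ T} (s : r ⟶ r') (P : F.Pt a p q) :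
    s ▷ q = (P.res r).move (P.res r') (s ▷ p) := by
  obtain ⟨rfl, rfl⟩ := P
  rw [move_eq (s ▷ a)] <;> simp

/-- Elements with the same underlying arrow. -/
theorem move_eqToHom {P : F.Pt a p q} {Q : F.Pt a' p' q'} (h : a = a') (hp : p = p') :
    P.move Q (eqToHom hp) = eqToHom (by rw [← P.ho, ← Q.ho, h]) := by
  rw [move_eq (eqToHom h)] <;> simp

/-- Changing the names of the arrows underlying elements. -/
theorem move_congr {a₁ a₁' : T ⟶ F.apex} {p₁ p₁' : T ⟶ x} {q₁ q₁' : T ⟶ y} (P : F.Pt a p q)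
    (P₁ : F.Pt a₁ p₁ q₁) (Q : F.Pt a' p' q') (Q₁ : F.Pt a₁' p₁' q₁') (ha : a = a₁) (hb : a' = a₁')
    (θ : p ⟶ p') :
    P.move Q θ = eqToHom (by rw [← P.ho, ha, P₁.ho]) ≫
      P₁.move Q₁ (eqToHom (by rw [← P.hb, ha, P₁.hb]) ≫ θ ≫
        eqToHom (by rw [← Q.hb, hb, Q₁.hb])) ≫ eqToHom (by rw [← Q.ho, hb, Q₁.ho]) := by
  subst ha hb
  obtain ⟨rfl, rfl⟩ := P
  obtain ⟨rfl, rfl⟩ := P₁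
  obtain ⟨rfl, rfl⟩ := Q
  obtain ⟨rfl, rfl⟩ := Q₁
  simp

end Pt

/-- The two tautological elements over the overlap. -/
theorem ptL (F G : Fraction S x y) :
    F.Pt (F.overlap G).fst ((F.overlap G).fst ≫ F.left) ((F.overlap G).fst ≫ F.right) :=
  ⟨rfl, rfl⟩

theorem ptR (F G : Fraction S x y) :
    G.Pt (F.overlap G).snd ((F.overlap G).fst ≫ F.left) ((F.overlap G).snd ≫ G.right) :=
  ⟨(F.overlap G).w.symm, rfl⟩

/-- Local elements exist. -/
theorem exists_cover (F : Fraction S x z) {T : K} (p : T ⟶ x) : ∃ (R : K) (c : R ⟶ T)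
    (a : R ⟶ F.apex), S.mem c ∧ F.Pt a (c ≫ p) (a ≫ F.right) :=
  ⟨_, (S.pullback F.left F.left_mem p).fst, _, S.pullback_mem _ _ _,
    (S.pullback F.left F.left_mem p).w.symm, rfl⟩

namespace Hom

variable {F G H : Fraction S x y} {T R : K} {p p' p'' : T ⟶ x} {q q' q'' : T ⟶ y}
  {a : T ⟶ F.apex} {b : T ⟶ G.apex} {c : T ⟶ H.apex}

/-- Two restrictions of a map of fractions are compatible. -/
theorem cell_compat (t : Hom F G) (l l' : T ⟶ (F.overlap G).pt)
    (θ : l ≫ (F.overlap G).fst ≫ F.left ⟶ l' ≫ (F.overlap G).fst ≫ F.left) :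
    l ◁ t.cell ≫ ((F.ptR G).res l).move ((F.ptR G).res l') θ =
      ((F.ptL G).res l).move ((F.ptL G).res l') θ ≫ l' ◁ t.cell := by
  have hff : IsFF ((F.overlap G).fst ≫ F.left) :=
    S.mem_ff _ (S.comp_mem _ _ (S.pullback_mem _ _ _) F.left_mem)
  obtain ⟨s, hs, -⟩ := hff l l' θ
  subst hs
  rw [← Pt.whiskerRight_out s (F.ptR G), ← Pt.whiskerRight_out s (F.ptL G), whisker_exchange]

/-- The relation `e = t(P, Q, θ)`, for elements `P` of `F` and `Q` of `G` and a 2-arrow `θ` between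
their images in `x`. -/
def IsVal (t : Hom F G) (P : F.Pt a p q) (Q : G.Pt b p' q') (θ : p ⟶ p') (e : q ⟶ q') : Prop :=
  ∀ ⦃R : K⦄ (r : R ⟶ T) (l : R ⟶ (F.overlap G).pt)
    (θ₁ : r ≫ p ⟶ l ≫ (F.overlap G).fst ≫ F.left)
    (θ₂ : l ≫ (F.overlap G).fst ≫ F.left ⟶ r ≫ p'), θ₁ ≫ θ₂ = r ◁ θ →
    r ◁ e = (P.res r).move ((F.ptL G).res l) θ₁ ≫ l ◁ t.cell ≫
      ((F.ptR G).res l).move (Q.res r) θ₂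

theorem val_res {t : Hom F G} {P : F.Pt a p q} {Q : G.Pt b p' q'}
    {R' : K} (k : R' ⟶ R) (r : R ⟶ T) (l : R ⟶ (F.overlap G).pt)
    (θ₁ : r ≫ p ⟶ l ≫ (F.overlap G).fst ≫ F.left)
    (θ₂ : l ≫ (F.overlap G).fst ≫ F.left ⟶ r ≫ p') :
    (P.res (k ≫ r)).move ((F.ptL G).res (k ≫ l)) ((α_ _ _ _).hom ≫ k ◁ θ₁ ≫ (α_ _ _ _).inv) ≫
      (k ≫ l) ◁ t.cell ≫
      ((F.ptR G).res (k ≫ l)).move (Q.res (k ≫ r)) ((α_ _ _ _).hom ≫ k ◁ θ₂ ≫ (α_ _ _ _).inv) =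
    (α_ _ _ _).hom ≫ k ◁ ((P.res r).move ((F.ptL G).res l) θ₁ ≫ l ◁ t.cell ≫
      ((F.ptR G).res l).move (Q.res r) θ₂) ≫ (α_ _ _ _).inv := by
  rw [← Pt.move_move _ ((P.res r).res k) ((P.res r).res k),
    ← Pt.move_move _ (((F.ptL G).res l).res k) (((F.ptL G).res l).res k),
    ← Pt.move_move _ (((F.ptR G).res l).res k) (((F.ptR G).res l).res k),
    ← Pt.move_move _ ((Q.res r).res k) ((Q.res r).res k),
    ← Pt.res_move k (P.res r) ((F.ptL G).res l), ← Pt.res_move k ((F.ptR G).res l) (Q.res r)]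
  simp [Pt.move_eqToHom]

theorem val_indep {t : Hom F G} {P : F.Pt a p q} {Q : G.Pt b p' q'}
    {l l' : T ⟶ (F.overlap G).pt}
    (θ₁ : p ⟶ l ≫ (F.overlap G).fst ≫ F.left) (θ₂ : l ≫ (F.overlap G).fst ≫ F.left ⟶ p')
    (θ₁' : p ⟶ l' ≫ (F.overlap G).fst ≫ F.left) (θ₂' : l' ≫ (F.overlap G).fst ≫ F.left ⟶ p')
    [IsIso θ₂'] (h : θ₁ ≫ θ₂ = θ₁' ≫ θ₂') :
    P.move ((F.ptL G).res l) θ₁ ≫ l ◁ t.cell ≫ ((F.ptR G).res l).move Q θ₂ =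
      P.move ((F.ptL G).res l') θ₁' ≫ l' ◁ t.cell ≫ ((F.ptR G).res l').move Q θ₂' := by
  obtain rfl : θ₁' = θ₁ ≫ θ₂ ≫ inv θ₂' := by simp [← Category.assoc, h]
  have := congrArg (· ≫ ((F.ptR G).res l').move Q θ₂') (t.cell_compat l l' (θ₂ ≫ inv θ₂'))
  rw [Category.assoc, Category.assoc] at this
  rw [← Pt.move_move _ ((F.ptL G).res l) ((F.ptL G).res l), Category.assoc, ← this]
  simp

theorem existsUnique_val (t : Hom F G) (P : F.Pt a p q) (Q : G.Pt b p' q') (θ : p ⟶ p') :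
    ∃! e : q ⟶ q', IsVal t P Q θ e := by
  have := S.glue (f := q) (g := q') (fun R r e ↦ ∃ (l : R ⟶ (F.overlap G).pt)
    (θ₁ : r ≫ p ⟶ l ≫ (F.overlap G).fst ≫ F.left)
    (θ₂ : l ≫ (F.overlap G).fst ≫ F.left ⟶ r ≫ p'), θ₁ ≫ θ₂ = r ◁ θ ∧
    e = (P.res r).move ((F.ptL G).res l) θ₁ ≫ l ◁ t.cell ≫
      ((F.ptR G).res l).move (Q.res r) θ₂) ?_ ?_ ?_
  · obtain ⟨e, he, hu⟩ := this
    exact ⟨e, fun R r l θ₁ θ₂ h ↦ he r _ ⟨l, θ₁, θ₂, h, rfl⟩,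
      fun e' he' ↦ hu e' fun R r a ⟨l, θ₁, θ₂, h, ha⟩ ↦ (he' r l θ₁ θ₂ h).trans ha.symm⟩
  · rintro R r _ _ ⟨l, θ₁, θ₂, h, rfl⟩ ⟨l', θ₁', θ₂', h', rfl⟩
    obtain ⟨R', c, m, hc, hm⟩ := exists_cover F (r ≫ p')
    apply StrictTwoSite.cover_ext hc
    have e1 : (F.overlap G).lift m (c ≫ r ≫ b) (by rw [hm.hb, Strict.assoc, Strict.assoc, Q.hb]) ≫
        (F.overlap G).fst ≫ F.left = (c ≫ r) ≫ p' := by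
      rw [← Strict.assoc, StrictPullback.lift_fst, hm.hb, Strict.assoc]
    have e2 := val_res (t := t) (P := P) (Q := Q) c r l θ₁ θ₂
    have e3 := val_res (t := t) (P := P) (Q := Q) c r l' θ₁' θ₂'
    have e4 : ((α_ _ _ _).hom ≫ c ◁ θ₁ ≫ (α_ _ _ _).inv) ≫
        ((α_ _ _ _).hom ≫ c ◁ θ₂ ≫ (α_ _ _ _).inv) = (c ≫ r) ◁ θ ≫ eqToHom e1.symm ≫
          eqToHom e1 := by
      have := congrArg (c ◁ ·) h
      simp only [whiskerLeft_comp] at this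
      rw [comp_whiskerLeft, ← this]
      simp
    have e5 : ((α_ _ _ _).hom ≫ c ◁ θ₁' ≫ (α_ _ _ _).inv) ≫
        ((α_ _ _ _).hom ≫ c ◁ θ₂' ≫ (α_ _ _ _).inv) = (c ≫ r) ◁ θ ≫ eqToHom e1.symm ≫
          eqToHom e1 := by
      have := congrArg (c ◁ ·) h'
      simp only [whiskerLeft_comp] at this
      rw [comp_whiskerLeft, ← this]
      simp
    rw [← Category.assoc ((c ≫ r) ◁ θ)] at e4 e5
    rw [val_indep _ _ _ _ e4] at e2
    rw [val_indep _ _ _ _ e5] at e3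
    have := e2.symm.trans e3
    rwa [cancel_epi, cancel_mono] at this
  · rintro R R' k r _ ⟨l, θ₁, θ₂, h, rfl⟩
    refine ⟨k ≫ l, (α_ _ _ _).hom ≫ k ◁ θ₁ ≫ (α_ _ _ _).inv, (α_ _ _ _).hom ≫ k ◁ θ₂ ≫ (α_ _ _ _).inv, ?_, ?_⟩
    · have := congrArg (k ◁ ·) h
      simp only [whiskerLeft_comp] at this
      rw [comp_whiskerLeft, ← this]
      simp
    · rw [val_res (P := P) (Q := Q)]
  · obtain ⟨R, c, a, hc, ha⟩ := exists_cover F p'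
    refine ⟨R, c, _, hc, (F.overlap G).lift a (c ≫ b) ?_, c ◁ θ ≫ eqToHom ?_, eqToHom ?_, ?_, rfl⟩
    · rw [ha.hb, Strict.assoc, Q.hb]
    · rw [← Strict.assoc, StrictPullback.lift_fst, ha.hb]
    · rw [← Strict.assoc, StrictPullback.lift_fst, ha.hb]
    · simp

/-- The 2-arrow `t(P, Q, θ)` obtained from a map of fractions `t : F ⟶ G`, elements `P` of `F` and
`Q` of `G` and a 2-arrow `θ` between their images in `x`. -/
noncomputable def eval (t : Hom F G) (P : F.Pt a p q) (Q : G.Pt b p' q') (θ : p ⟶ p') : q ⟶ q' :=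
  (existsUnique_val t P Q θ).choose

theorem eval_isVal (t : Hom F G) (P : F.Pt a p q) (Q : G.Pt b p' q') (θ : p ⟶ p') :
    IsVal t P Q θ (t.eval P Q θ) := (existsUnique_val t P Q θ).choose_spec.1

theorem eval_eq (t : Hom F G) {P : F.Pt a p q} {Q : G.Pt b p' q'} {θ : p ⟶ p'} {e : q ⟶ q'}
    (h : IsVal t P Q θ e) : t.eval P Q θ = e := ((existsUnique_val t P Q θ).choose_spec.2 e h).symm

theorem eval_formula (t : Hom F G) (P : F.Pt a p q) (Q : G.Pt b p' q')
    (l : T ⟶ (F.overlap G).pt) (θ₁ : p ⟶ l ≫ (F.overlap G).fst ≫ F.left)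
    (θ₂ : l ≫ (F.overlap G).fst ≫ F.left ⟶ p') :
    t.eval P Q (θ₁ ≫ θ₂) =
      P.move ((F.ptL G).res l) θ₁ ≫ l ◁ t.cell ≫ ((F.ptR G).res l).move Q θ₂ := by
  have h := t.eval_isVal P Q (θ₁ ≫ θ₂) (𝟙 T) l ((λ_ _).hom ≫ θ₁) (θ₂ ≫ (λ_ _).inv) (by simp)
  rw [← Pt.move_move _ P P, ← Pt.move_move _ Q Q, Strict.leftUnitor_eqToIso,
    Strict.leftUnitor_eqToIso, eqToIso.hom, eqToIso.inv, Pt.move_eqToHom (Strict.id_comp a),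
    Pt.move_eqToHom (Strict.id_comp b).symm, id_whiskerLeft, Strict.leftUnitor_eqToIso,
    Strict.leftUnitor_eqToIso, eqToIso.hom, eqToIso.inv, Category.assoc, cancel_epi] at h
  refine (cancel_mono (eqToHom (Strict.id_comp q').symm)).1 ?_
  simpa using h

theorem res_eval (r : R ⟶ T) (t : Hom F G) (P : F.Pt a p q) (Q : G.Pt b p' q') (θ : p ⟶ p') :
    r ◁ t.eval P Q θ = t.eval (P.res r) (Q.res r) (r ◁ θ) := by
  refine (t.eval_eq ?_).symm
  intro R' k l θ₁ θ₂ h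
  have := t.eval_isVal P Q θ (k ≫ r) l ((α_ _ _ _).hom ≫ θ₁) (θ₂ ≫ (α_ _ _ _).inv) (by
    rw [comp_whiskerLeft, ← h]; simp)
  rw [comp_whiskerLeft, ← Pt.move_move _ ((P.res r).res k) ((P.res r).res k),
    ← Pt.move_move _ ((Q.res r).res k) ((Q.res r).res k)] at this
  simp only [Strict.associator_eqToIso, eqToIso.hom, eqToIso.inv] at this
  rw [Pt.move_eqToHom (Strict.assoc _ _ _), Pt.move_eqToHom (Strict.assoc _ _ _).symm] at this
  refine (cancel_epi (eqToHom (Strict.assoc k r q))).1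
    ((cancel_mono (eqToHom (Strict.assoc k r q').symm)).1 ?_)
  simpa using this

theorem exists_formula (F : Fraction S x y) (Q : G.Pt b p' q') : ∃ (R : K) (c : R ⟶ T)
    (l : R ⟶ (F.overlap G).pt) (_ : l ≫ (F.overlap G).fst ≫ F.left = c ≫ p'), S.mem c := by
  obtain ⟨R, c, a, hc, ha⟩ := exists_cover F p'
  refine ⟨R, c, (F.overlap G).lift a (c ≫ b) ?_, ?_, hc⟩
  · rw [ha.hb, Strict.assoc, Q.hb]
  · rw [← Strict.assoc, StrictPullback.lift_fst, ha.hb]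

@[simp]
theorem move_eval (t : Hom F G) {a' : T ⟶ F.apex} (P : F.Pt a p q) (P₁ P₂ : F.Pt a' p' q')
    (Q : G.Pt b p'' q'') (φ : p ⟶ p') (θ : p' ⟶ p'') :
    P.move P₁ φ ≫ t.eval P₂ Q θ = t.eval P Q (φ ≫ θ) := by
  obtain ⟨R, c, l, hl, hc⟩ := exists_formula F Q
  apply StrictTwoSite.cover_ext hc
  have e1 : c ◁ θ = (c ◁ θ ≫ eqToHom hl.symm) ≫ eqToHom hl := by simp
  have e2 : c ◁ (φ ≫ θ) = (c ◁ φ ≫ c ◁ θ ≫ eqToHom hl.symm) ≫ eqToHom hl := by simp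
  rw [whiskerLeft_comp, res_eval, res_eval, e1, e2, eval_formula, eval_formula, Pt.res_move]
  simp

@[simp]
theorem move_eval_assoc (t : Hom F G) {a' : T ⟶ F.apex} (P : F.Pt a p q) (P₁ P₂ : F.Pt a' p' q')
    (Q : G.Pt b p'' q'') (φ : p ⟶ p') (θ : p' ⟶ p'') {s : T ⟶ y} (e : q'' ⟶ s) :
    P.move P₁ φ ≫ t.eval P₂ Q θ ≫ e = t.eval P Q (φ ≫ θ) ≫ e := by
  rw [← Category.assoc, move_eval]

@[simp]
theorem eval_move (t : Hom F G) {b' : T ⟶ G.apex} (P : F.Pt a p q) (Q₁ Q₂ : G.Pt b p' q')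
    (Q : G.Pt b' p'' q'') (φ : p ⟶ p') (θ : p' ⟶ p'') :
    t.eval P Q₁ φ ≫ Q₂.move Q θ = t.eval P Q (φ ≫ θ) := by
  obtain ⟨R, c, l, hl, hc⟩ := exists_formula F Q₁
  apply StrictTwoSite.cover_ext hc
  have e1 : c ◁ φ = (c ◁ φ ≫ eqToHom hl.symm) ≫ eqToHom hl := by simp
  have e2 : c ◁ (φ ≫ θ) = (c ◁ φ ≫ eqToHom hl.symm) ≫ eqToHom hl ≫ c ◁ θ := by simp
  rw [whiskerLeft_comp, res_eval, res_eval, e1, e2, eval_formula, eval_formula, Pt.res_move]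
  simp

@[simp]
theorem eval_move_assoc (t : Hom F G) {b' : T ⟶ G.apex} (P : F.Pt a p q) (Q₁ Q₂ : G.Pt b p' q')
    (Q : G.Pt b' p'' q'') (φ : p ⟶ p') (θ : p' ⟶ p'') {s : T ⟶ y} (e : q'' ⟶ s) :
    t.eval P Q₁ φ ≫ Q₂.move Q θ ≫ e = t.eval P Q (φ ≫ θ) ≫ e := by
  rw [← Category.assoc, eval_move]

theorem eval_cell (t : Hom F G) : t.eval (F.ptL G) (F.ptR G) (𝟙 _) = t.cell := by
  have := t.eval_formula (F.ptL G) (F.ptR G) (𝟙 _) (λ_ _).inv (λ_ _).hom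
  rw [Iso.inv_hom_id] at this
  rw [this, Strict.leftUnitor_eqToIso, eqToIso.hom, eqToIso.inv,
    Pt.move_eqToHom (Strict.id_comp _).symm, Pt.move_eqToHom (Strict.id_comp _)]
  simp [Strict.leftUnitor_eqToIso]

theorem ext_eval {t t' : Hom F G} (h : ∀ ⦃T : K⦄ ⦃a : T ⟶ F.apex⦄ ⦃b : T ⟶ G.apex⦄
    ⦃p p' : T ⟶ x⦄ ⦃q q' : T ⟶ y⦄ (P : F.Pt a p q) (Q : G.Pt b p' q') (θ : p ⟶ p'),
    t.eval P Q θ = t'.eval P Q θ) : t = t' := by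
  ext
  rw [← eval_cell, ← eval_cell, h]

theorem eval_at (t : Hom F G) (h : a ≫ F.left = b ≫ G.left) :
    t.at a b h = t.eval (p := a ≫ F.left) (p' := a ≫ F.left) ⟨rfl, rfl⟩ ⟨h.symm, rfl⟩ (𝟙 _) := by
  have e : (F.overlap G).lift a b h ≫ (F.overlap G).fst ≫ F.left = a ≫ F.left := by
    rw [← Strict.assoc, StrictPullback.lift_fst]
  have := t.eval_formula (p := a ≫ F.left) (p' := a ≫ F.left) ⟨rfl, rfl⟩ ⟨h.symm, rfl⟩
    ((F.overlap G).lift a b h) (eqToHom e.symm) (eqToHom e)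
  rw [Pt.move_eqToHom (by simp), Pt.move_eqToHom (by simp), eqToHom_trans, eqToHom_refl] at this
  rw [this, Hom.at]

/-- A natural family of 2-arrows indexed by pairs of elements. -/
structure Fam (F G : Fraction S x y) where
  val : ∀ ⦃T : K⦄ ⦃a : T ⟶ F.apex⦄ ⦃b : T ⟶ G.apex⦄
    ⦃p p' : T ⟶ x⦄ ⦃q q' : T ⟶ y⦄ (_ : F.Pt a p q) (_ : G.Pt b p' q') (_ : p ⟶ p'), q ⟶ q'
  res : ∀ ⦃R T : K⦄ (r : R ⟶ T) ⦃a : T ⟶ F.apex⦄ ⦃b : T ⟶ G.apex⦄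
    ⦃p p' : T ⟶ x⦄ ⦃q q' : T ⟶ y⦄ (P : F.Pt a p q) (Q : G.Pt b p' q') (θ : p ⟶ p'),
    r ◁ val P Q θ = val (P.res r) (Q.res r) (r ◁ θ)
  nat : ∀ ⦃T : K⦄ ⦃a a' : T ⟶ F.apex⦄ ⦃b b' : T ⟶ G.apex⦄
    ⦃p₁ p₂ p₃ p₄ : T ⟶ x⦄ ⦃q₁ q₂ q₃ q₄ : T ⟶ y⦄ (P' : F.Pt a' p₁ q₁) (P : F.Pt a p₂ q₂)
    (Q : G.Pt b p₃ q₃) (Q' : G.Pt b' p₄ q₄) (φ : p₁ ⟶ p₂) (θ : p₂ ⟶ p₃) (ψ : p₃ ⟶ p₄),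
    P'.move P φ ≫ val P Q θ ≫ Q.move Q' ψ = val P' Q' (φ ≫ θ ≫ ψ)

/-- The map of fractions with given values. -/
def ofFam (τ : Fam F G) : Hom F G where
  cell := τ.val (F.ptL G) (F.ptR G) (𝟙 _)

theorem eval_ofFam (τ : Fam F G) (P : F.Pt a p q) (Q : G.Pt b p' q') (θ : p ⟶ p') :
    (ofFam τ).eval P Q θ = τ.val P Q θ := by
  obtain ⟨R, c, l, hl, hc⟩ := exists_formula F Q
  apply StrictTwoSite.cover_ext hc
  have e1 : c ◁ θ = (c ◁ θ ≫ eqToHom hl.symm) ≫ eqToHom hl := by simp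
  rw [res_eval, τ.res, e1, eval_formula, ofFam, τ.res, τ.nat]
  simp

/-- 2-arrows may be compared after passing to a cover over which a fraction has an element. -/
theorem local_ext (X : Fraction S x z) (p₀ : T ⟶ x) {q q' : T ⟶ y} {e e' : q ⟶ q'}
    (h : ∀ ⦃R : K⦄ (c : R ⟶ T) (m : R ⟶ X.apex), X.Pt m (c ≫ p₀) (m ≫ X.right) →
      c ◁ e = c ◁ e') : e = e' := by
  obtain ⟨R, c, m, hc, hm⟩ := exists_cover X p₀
  exact StrictTwoSite.cover_ext hc (h c m hm)

theorem ext_eval₁ {z : K} (X : Fraction S x z) {t t' : Hom F G}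
    (h : ∀ ⦃T : K⦄ ⦃a : T ⟶ F.apex⦄ ⦃b : T ⟶ G.apex⦄ ⦃m : T ⟶ X.apex⦄
    ⦃p p' : T ⟶ x⦄ ⦃q q' : T ⟶ y⦄ ⦃s : T ⟶ z⦄ (P : F.Pt a p q) (Q : G.Pt b p' q')
    (_ : X.Pt m p s) (θ : p ⟶ p'), t.eval P Q θ = t'.eval P Q θ) : t = t' := by
  apply ext_eval
  intro T a b p p' q q' P Q θ
  apply local_ext X p
  intro R c m hm
  rw [res_eval, res_eval]
  exact h _ _ hm _

theorem ext_eval₂ {z z' : K} (X : Fraction S x z) (Y : Fraction S x z') {t t' : Hom F G}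
    (h : ∀ ⦃T : K⦄ ⦃a : T ⟶ F.apex⦄ ⦃b : T ⟶ G.apex⦄ ⦃m : T ⟶ X.apex⦄ ⦃n : T ⟶ Y.apex⦄
    ⦃p p' : T ⟶ x⦄ ⦃q q' : T ⟶ y⦄ ⦃s : T ⟶ z⦄ ⦃s' : T ⟶ z'⦄ (P : F.Pt a p q) (Q : G.Pt b p' q')
    (_ : X.Pt m p s) (_ : Y.Pt n p s') (θ : p ⟶ p'), t.eval P Q θ = t'.eval P Q θ) : t = t' := by
  apply ext_eval₁ X
  intro T a b m p p' q q' s P Q M θ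
  apply local_ext Y p
  intro R c n hn
  rw [res_eval, res_eval]
  exact h _ _ (M.res c) hn _

theorem eval_id (P : F.Pt a p q) {b : T ⟶ F.apex} (Q : F.Pt b p' q') (θ : p ⟶ p') :
    (Hom.id F).eval P Q θ = P.move Q θ := by
  let τ : Fam F F := ⟨fun T a b p p' q q' P Q θ ↦ P.move Q θ, by
    intros; apply Pt.res_move, by intros; simp⟩
  have : Hom.id F = ofFam τ := by
    ext
    simp [Hom.id, ofFam, τ, Pt.move]
  rw [this, eval_ofFam]

theorem comp_aux {F₁ F₂ F₃ : Fraction S x y} (t₁ : Hom F₁ F₂) (t₂ : Hom F₂ F₃) {a : T ⟶ F₁.apex}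
    {b : T ⟶ F₃.apex} (P : F₁.Pt a p q) (Q : F₃.Pt b p' q') (θ : p ⟶ p') :
    ∃! e : q ⟶ q', ∀ ⦃R : K⦄ (r : R ⟶ T) (m : R ⟶ F₂.apex) (p₀ : R ⟶ x) (q₀ : R ⟶ y)
      (M : F₂.Pt m p₀ q₀) (θ₁ : r ≫ p ⟶ p₀) (θ₂ : p₀ ⟶ r ≫ p'), θ₁ ≫ θ₂ = r ◁ θ →
      r ◁ e = t₁.eval (P.res r) M θ₁ ≫ t₂.eval M (Q.res r) θ₂ := by
  have key : ∀ {T : K} {p p' : T ⟶ x} {q q' : T ⟶ y} {a : T ⟶ F₁.apex} {b : T ⟶ F₃.apex}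
      (P : F₁.Pt a p q) (Q : F₃.Pt b p' q') {m m' : T ⟶ F₂.apex} {p₀ p₁ : T ⟶ x} {q₀ q₁ : T ⟶ y}
      (M : F₂.Pt m p₀ q₀) (M' : F₂.Pt m' p₁ q₁) (θ₁ : p ⟶ p₀) (θ₂ : p₀ ⟶ p') (θ₁' : p ⟶ p₁)
      (θ₂' : p₁ ⟶ p') [IsIso θ₂'], θ₁ ≫ θ₂ = θ₁' ≫ θ₂' →
      t₁.eval P M θ₁ ≫ t₂.eval M Q θ₂ = t₁.eval P M' θ₁' ≫ t₂.eval M' Q θ₂' := by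
    intro T p p' q q' a b P Q m m' p₀ p₁ q₀ q₁ M M' θ₁ θ₂ θ₁' θ₂' _ h
    obtain rfl : θ₁' = θ₁ ≫ θ₂ ≫ inv θ₂' := by simp [← Category.assoc, h]
    rw [← eval_move t₁ P M M M' θ₁ (θ₂ ≫ inv θ₂'), Category.assoc, move_eval]
    simp
  have hres : ∀ {R R' : K} (k : R' ⟶ R) (r : R ⟶ T) {m : R ⟶ F₂.apex} {p₀ : R ⟶ x} {q₀ : R ⟶ y}
      (M : F₂.Pt m p₀ q₀) (θ₁ : r ≫ p ⟶ p₀) (θ₂ : p₀ ⟶ r ≫ p'),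
      (α_ k r q).hom ≫ k ◁ (t₁.eval (P.res r) M θ₁ ≫ t₂.eval M (Q.res r) θ₂) ≫ (α_ k r q').inv =
      t₁.eval (P.res (k ≫ r)) (M.res k) ((α_ k r p).hom ≫ k ◁ θ₁) ≫
        t₂.eval (M.res k) (Q.res (k ≫ r)) (k ◁ θ₂ ≫ (α_ k r p').inv) := by
    intro R R' k r m p₀ q₀ M θ₁ θ₂
    rw [← move_eval t₁ (P.res (k ≫ r)) ((P.res r).res k) ((P.res r).res k),
      ← eval_move t₂ (M.res k) ((Q.res r).res k) ((Q.res r).res k) (Q.res (k ≫ r)), ← res_eval k t₁ (P.res r) M,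
      ← res_eval k t₂ M (Q.res r)]
    simp [Pt.move_eqToHom]
  have := S.glue (f := q) (g := q') (fun R r e ↦ ∃ (m : R ⟶ F₂.apex) (p₀ : R ⟶ x) (q₀ : R ⟶ y)
      (M : F₂.Pt m p₀ q₀) (θ₁ : r ≫ p ⟶ p₀) (θ₂ : p₀ ⟶ r ≫ p'), θ₁ ≫ θ₂ = r ◁ θ ∧
      e = t₁.eval (P.res r) M θ₁ ≫ t₂.eval M (Q.res r) θ₂) ?_ ?_ ?_
  · obtain ⟨e, he, hu⟩ := this
    exact ⟨e, fun R r m p₀ q₀ M θ₁ θ₂ h ↦ he r _ ⟨m, p₀, q₀, M, θ₁, θ₂, h, rfl⟩,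
      fun e' he' ↦ hu e' fun R r a ⟨m, p₀, q₀, M, θ₁, θ₂, h, ha⟩ ↦
        (he' r m p₀ q₀ M θ₁ θ₂ h).trans ha.symm⟩
  · rintro R r _ _ ⟨m, p₀, q₀, M, θ₁, θ₂, h, rfl⟩ ⟨m', p₁, q₁, M', θ₁', θ₂', h', rfl⟩
    apply local_ext F₂ (r ≫ p')
    intro R' c n N
    refine (cancel_mono (α_ c r q').inv).1 ((cancel_epi (α_ c r q).hom).1 ?_)
    rw [hres, hres, key _ _ (M.res c) N _ _ ((c ≫ r) ◁ θ ≫ (α_ _ _ _).hom) (α_ _ _ _).inv,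
      key _ _ (M'.res c) N _ _ ((c ≫ r) ◁ θ ≫ (α_ _ _ _).hom) (α_ _ _ _).inv]
    · rw [comp_whiskerLeft, ← h']; simp
    · rw [comp_whiskerLeft, ← h]; simp
  · rintro R R' k r _ ⟨m, p₀, q₀, M, θ₁, θ₂, h, rfl⟩
    exact ⟨_, _, _, M.res k, (α_ k r p).hom ≫ k ◁ θ₁, k ◁ θ₂ ≫ (α_ k r p').inv, by
      rw [comp_whiskerLeft, ← h]; simp, hres ..⟩
  · obtain ⟨R, c, m, hc, M⟩ := exists_cover F₂ p'
    exact ⟨R, c, _, hc, m, _, _, M, c ◁ θ, 𝟙 _, by simp, rfl⟩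

theorem eval_congr (t : Hom F G) {a₁ : T ⟶ F.apex} {b₁ : T ⟶ G.apex} {p₁ p₁' : T ⟶ x}
    {q₁ q₁' : T ⟶ y} (P : F.Pt a p q) (P₁ : F.Pt a₁ p₁ q₁) (Q : G.Pt b p' q') (Q₁ : G.Pt b₁ p₁' q₁')
    (ha : a = a₁) (hb : b = b₁) (θ : p ⟶ p') :
    t.eval P Q θ = eqToHom (by rw [← P.ho, ha, P₁.ho]) ≫
      t.eval P₁ Q₁ (eqToHom (by rw [← P.hb, ha, P₁.hb]) ≫ θ ≫
        eqToHom (by rw [← Q.hb, hb, Q₁.hb])) ≫ eqToHom (by rw [← Q.ho, hb, Q₁.ho]) := by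
  subst ha hb
  obtain ⟨rfl, rfl⟩ := P
  obtain ⟨rfl, rfl⟩ := P₁
  obtain ⟨rfl, rfl⟩ := Q
  obtain ⟨rfl, rfl⟩ := Q₁
  simp

theorem eval_at' (t : Hom F G) {a₁ : T ⟶ F.apex} {b₁ : T ⟶ G.apex} (h : a ≫ F.left = b ≫ G.left)
    (P : F.Pt a₁ p q) (Q : G.Pt b₁ p' q') (ha : a = a₁) (hb : b = b₁) :
    t.at a b h = eqToHom (by rw [ha, P.ho]) ≫
      t.eval P Q (eqToHom (by rw [← P.hb, ← ha, h, hb, Q.hb])) ≫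
      eqToHom (by rw [hb, Q.ho]) := by
  rw [eval_at, eval_congr t _ P _ Q ha hb]
  simp

section

variable {F₁ F₂ F₃ : Fraction S x y} (t₁ : Hom F₁ F₂) (t₂ : Hom F₂ F₃) {a : T ⟶ F₁.apex}
  {b : T ⟶ F₃.apex} {m : T ⟶ F₂.apex}

/-- Values of a vertical composite. -/
noncomputable def cval (P : F₁.Pt a p q) (Q : F₃.Pt b p' q') (θ : p ⟶ p') : q ⟶ q' :=
  (comp_aux t₁ t₂ P Q θ).choose

theorem cval_formula (P : F₁.Pt a p q) (M : F₂.Pt m p' q') (Q : F₃.Pt b p'' q'')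
    (θ : p ⟶ p') (θ' : p' ⟶ p'') :
    cval t₁ t₂ P Q (θ ≫ θ') = t₁.eval P M θ ≫ t₂.eval M Q θ' := by
  have h := (comp_aux t₁ t₂ P Q (θ ≫ θ')).choose_spec.1 (𝟙 T) m p' q' M ((λ_ _).hom ≫ θ)
    (θ' ≫ (λ_ _).inv) (by simp)
  rw [← move_eval _ _ P P, ← eval_move _ _ Q Q, Strict.leftUnitor_eqToIso,
    Strict.leftUnitor_eqToIso, eqToIso.hom, eqToIso.inv, Pt.move_eqToHom (Strict.id_comp a),
    Pt.move_eqToHom (Strict.id_comp b).symm, id_whiskerLeft, Strict.leftUnitor_eqToIso,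
    Strict.leftUnitor_eqToIso, eqToIso.hom, eqToIso.inv, Category.assoc, cancel_epi] at h
  refine (cancel_mono (eqToHom (Strict.id_comp q'').symm)).1 ?_
  rw [Category.assoc]
  exact h

theorem res_cval (r : R ⟶ T) (P : F₁.Pt a p q) (Q : F₃.Pt b p' q') (θ : p ⟶ p') :
    r ◁ cval t₁ t₂ P Q θ = cval t₁ t₂ (P.res r) (Q.res r) (r ◁ θ) := by
  refine (comp_aux t₁ t₂ (P.res r) (Q.res r) (r ◁ θ)).choose_spec.2 _ ?_
  intro R' k m p₀ q₀ M θ₁ θ₂ h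
  have : (k ≫ r) ◁ cval t₁ t₂ P Q θ = _ :=
    (comp_aux t₁ t₂ P Q θ).choose_spec.1 (k ≫ r) m p₀ q₀ M ((α_ _ _ _).hom ≫ θ₁)
    (θ₂ ≫ (α_ _ _ _).inv) (by rw [comp_whiskerLeft, ← h]; simp)
  rw [comp_whiskerLeft, ← move_eval _ _ ((P.res r).res k) ((P.res r).res k),
    ← eval_move _ _ ((Q.res r).res k) ((Q.res r).res k)] at this
  simp only [Strict.associator_eqToIso, eqToIso.hom, eqToIso.inv] at this
  rw [Pt.move_eqToHom (Strict.assoc _ _ _), Pt.move_eqToHom (Strict.assoc _ _ _).symm] at this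
  refine (cancel_epi (eqToHom (Strict.assoc k r q))).1
    ((cancel_mono (eqToHom (Strict.assoc k r q').symm)).1 ?_)
  simpa using this

theorem eval_comp (P : F₁.Pt a p q) (M : F₂.Pt m p' q') (Q : F₃.Pt b p'' q'')
    (θ : p ⟶ p') (θ' : p' ⟶ p'') :
    (Hom.comp t₁ t₂).eval P Q (θ ≫ θ') = t₁.eval P M θ ≫ t₂.eval M Q θ' := by
  let τ : Fam F₁ F₃ := ⟨fun T a b p p' q q' P Q θ ↦ cval t₁ t₂ P Q θ, by
    intros; apply res_cval, by
    intro T a a' b b' p₁ p₂ p₃ p₄ q₁ q₂ q₃ q₄ P' P Q Q' φ θ ψ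
    apply local_ext F₂ p₂
    intro R c m M
    rw [whiskerLeft_comp, whiskerLeft_comp, res_cval, res_cval, Pt.res_move, Pt.res_move,
      ← Category.id_comp (c ◁ θ), cval_formula t₁ t₂ (P.res c) M (Q.res c), whiskerLeft_comp,
      cval_formula t₁ t₂ (P'.res c) M (Q'.res c)]
    simp⟩
  have : Hom.comp t₁ t₂ = ofFam τ := by
    ext
    apply StrictTwoSite.cover_ext
      (S.pullback_mem F₂.left F₂.left_mem ((F₁.overlap F₃).fst ≫ F₁.left))
    dsimp only [Hom.comp, ofFam, τ]
    rw [StrictTwoSite.whisker_desc, res_cval]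
    let Q := S.pullback F₂.left F₂.left_mem ((F₁.overlap F₃).fst ≫ F₁.left)
    have M : F₂.Pt Q.snd (Q.fst ≫ (F₁.overlap F₃).fst ≫ F₁.left) (Q.snd ≫ F₂.right) :=
      ⟨Q.w.symm, rfl⟩
    rw [← Category.comp_id (_ ◁ 𝟙 _), cval_formula t₁ t₂ _ M, eval_at, eval_at,
      eval_congr t₁ _ ((F₁.ptL F₃).res _) _ M rfl rfl,
      eval_congr t₂ _ M _ ((F₁.ptR F₃).res _) rfl rfl]
    simp
    rfl
  rw [this, eval_ofFam]
  exact cval_formula ..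

end

end Hom

namespace Pt

variable {F : Fraction S x y} {G : Fraction S y z} {T R : K} {p p' : T ⟶ x} {q q' : T ⟶ z}
  {c d : T ⟶ (F.comp G).apex}

/-- The first component of an element of a composite fraction. -/
theorem l (C : (F.comp G).Pt c p q) :
    F.Pt (c ≫ (S.pullback G.left G.left_mem F.right).fst) p
      ((c ≫ (S.pullback G.left G.left_mem F.right).fst) ≫ F.right) :=
  ⟨(Strict.assoc _ _ _).trans C.hb, rfl⟩

/-- The second component of an element of a composite fraction. -/
theorem r (C : (F.comp G).Pt c p q) :
    G.Pt (c ≫ (S.pullback G.left G.left_mem F.right).snd)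
      ((c ≫ (S.pullback G.left G.left_mem F.right).fst) ≫ F.right) q :=
  ⟨((S.pullback G.left G.left_mem F.right).comp_w c).symm, (Strict.assoc _ _ _).trans C.ho⟩

theorem move_comp (C : (F.comp G).Pt c p q) (D : (F.comp G).Pt d p' q') (θ : p ⟶ p') :
    C.move D θ = C.r.move D.r (C.l.move D.l θ) := by
  obtain ⟨s, hs⟩ := exists_lift C D θ
  let A := S.pullback G.left G.left_mem F.right
  have hs' : s ▷ (A.fst ≫ F.left) = _ := hs
  have e1 : C.l.move D.l θ = (s ▷ A.fst) ▷ F.right := by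
    rw [move_eq (s ▷ A.fst)]
    · simp [A]
    · rw [whiskerRight_comp, Strict.associator_eqToIso, Strict.associator_eqToIso] at hs'
      refine (cancel_epi (eqToHom (Strict.assoc _ _ _).symm)).1
        ((cancel_mono (eqToHom (Strict.assoc _ _ _))).1 ?_)
      simpa using hs'
  have e2 : (s ▷ A.fst) ▷ F.right = eqToHom (A.comp_w c) ≫ (s ▷ A.snd) ▷ G.left ≫
      eqToHom (A.comp_w d).symm := by
    have h1 := whiskerRight_comp s A.fst F.right
    have h2 := whiskerRight_comp s A.snd G.left
    have h3 := whiskerRight_congr A.w s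
    rw [h1, h2] at h3
    refine (cancel_epi (eqToHom (Strict.assoc _ _ _).symm)).1
        ((cancel_mono (eqToHom (Strict.assoc _ _ _))).1 ?_)
    simpa using h3
  rw [move_eq s hs, e1, e2, move_eq (P := C.r) (Q := D.r) (s ▷ A.snd) (by simp [A])]
  change _ ≫ s ▷ (A.snd ≫ G.right) ≫ _ = _
  simp

end Pt

namespace Hom

variable {F F' F'' : Fraction S x y} {G G' : Fraction S y z} {T R : K}
  {p p' p'' : T ⟶ x} {q q' q'' : T ⟶ z}

/-- Values of a horizontal composite. -/
noncomputable def hFam (t : Hom F F') (s : Hom G G') : Fam (F.comp G) (F'.comp G') where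
  val := fun _ _ _ _ _ _ _ C D θ ↦ s.eval C.r D.r (t.eval C.l D.l θ)
  res := by
    intro R T r a b p p' q q' C D θ
    rw [res_eval, res_eval, eval_congr t (C.res r).l (C.l.res r) (D.res r).l (D.l.res r)
      (Strict.assoc _ _ _) (Strict.assoc _ _ _),
      eval_congr s (C.res r).r (C.r.res r) (D.res r).r (D.r.res r)
      (Strict.assoc _ _ _) (Strict.assoc _ _ _)]
    simp
  nat := by
    intros
    simp [Pt.move_comp]

theorem eval_whiskerRight (t : Hom F F') (G : Fraction S y z) {a : T ⟶ (F.comp G).apex}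
    {b : T ⟶ (F'.comp G).apex} (C : (F.comp G).Pt a p q) (D : (F'.comp G).Pt b p' q')
    (θ : p ⟶ p') : (t.whiskerRight G).eval C D θ = C.r.move D.r (t.eval C.l D.l θ) := by
  have : t.whiskerRight G = ofFam (hFam t (Hom.id G)) := by
    ext
    dsimp only [Hom.whiskerRight, ofFam, hFam]
    rw [eval_id, eval_at' t _ (ptL (F.comp G) (F'.comp G)).l (ptR (F.comp G) (F'.comp G)).l
      rfl rfl,
      Pt.move]
    simp
  rw [this, eval_ofFam]
  simp only [hFam, eval_id]

theorem eval_whiskerLeft (F : Fraction S x y) (t : Hom G G') {a : T ⟶ (F.comp G).apex}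
    {b : T ⟶ (F.comp G').apex} (C : (F.comp G).Pt a p q) (D : (F.comp G').Pt b p' q')
    (θ : p ⟶ p') : (t.whiskerLeft F).eval C D θ = t.eval C.r D.r (C.l.move D.l θ) := by
  have : t.whiskerLeft F = ofFam (hFam (Hom.id F) t) := by
    ext
    let A := S.pullback G.left G.left_mem F.right
    let B := S.pullback G'.left G'.left_mem F.right
    let W : StrictPullback (B.fst ≫ F.left) (A.fst ≫ F.left) := (F.comp G).overlap (F.comp G')
    let N := G.overlap G'
    have hN : S.mem (N.fst ≫ G.left) := S.comp_mem _ _ (S.pullback_mem _ _ _) G.left_mem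
    let M := S.pullback (N.fst ≫ G.left) hN F.right
    have hM : S.mem (M.fst ≫ F.left) := S.comp_mem _ _ (S.pullback_mem _ _ _) F.left_mem
    let C := S.pullback (M.fst ≫ F.left) hM (W.fst ≫ A.fst ≫ F.left)
    let mA : M.pt ⟶ A.pt := A.lift M.fst (M.snd ≫ N.fst) (by rw [M.w, Strict.assoc])
    let mB : M.pt ⟶ B.pt := B.lift M.fst (M.snd ≫ N.snd)
      (by rw [M.w, Strict.assoc, ← N.w])
    have hmA : (C.snd ≫ mA) ≫ A.fst = C.snd ≫ M.fst := by rw [Strict.assoc, A.lift_fst]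
    have hmB : (C.snd ≫ mB) ≫ B.fst = C.snd ≫ M.fst := by rw [Strict.assoc, B.lift_fst]
    have hmA' : (C.snd ≫ mA) ≫ A.snd = C.snd ≫ M.snd ≫ N.fst := by rw [Strict.assoc, A.lift_snd]
    have hmB' : (C.snd ≫ mB) ≫ B.snd = C.snd ≫ M.snd ≫ N.snd := by rw [Strict.assoc, B.lift_snd]
    have XA : (F.comp G).Pt (C.snd ≫ mA) (C.fst ≫ W.fst ≫ A.fst ≫ F.left)
        ((C.snd ≫ mA) ≫ A.snd ≫ G.right) :=
      ⟨(Strict.assoc _ _ _).symm.trans ((congrArg (· ≫ F.left) hmA).trans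
        ((Strict.assoc _ _ _).trans C.w.symm)), rfl⟩
    have XB : (F.comp G').Pt (C.snd ≫ mB) (C.fst ≫ W.fst ≫ A.fst ≫ F.left)
        ((C.snd ≫ mB) ≫ B.snd ≫ G'.right) :=
      ⟨(Strict.assoc _ _ _).symm.trans ((congrArg (· ≫ F.left) hmB).trans
        ((Strict.assoc _ _ _).trans C.w.symm)), rfl⟩
    apply StrictTwoSite.cover_ext (S.pullback_mem _ hM (W.fst ≫ A.fst ≫ F.left))
    have e := (hFam (Hom.id F) t).nat ((ptL (F.comp G) (F.comp G')).res C.fst) XA XB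
      ((ptR (F.comp G) (F.comp G')).res C.fst) (𝟙 _) (𝟙 _) (𝟙 _)
    dsimp only [Hom.whiskerLeft, ofFam]
    rw [StrictTwoSite.whisker_desc, (hFam (Hom.id F) t).res, whiskerLeft_id]
    rw [Category.id_comp, Category.id_comp] at e
    refine Eq.trans ?_ e
    dsimp only [hFam]
    rw [eval_id, ← eqToHom_refl _ rfl, Pt.move_eqToHom (hmA.trans hmB.symm),
      eval_at' t _ XA.r XB.r hmA'.symm hmB'.symm, Pt.move, Pt.move]
    simp [A, B, W, N, M, C, mA, mB]
  rw [this, eval_ofFam]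
  simp only [hFam, eval_id]

theorem push {F G : Fraction S x y} {T : K} {p : T ⟶ x} {q : T ⟶ y} {a : T ⟶ F.apex}
    (P : F.Pt a p q) (r : F.apex ⟶ G.apex) (hl : r ≫ G.left = F.left)
    (hr : F.right = r ≫ G.right) : G.Pt (a ≫ r) p q :=
  ⟨by rw [Strict.assoc, hl, P.hb], by rw [Strict.assoc, ← hr, P.ho]⟩

theorem eval_renaming {F G : Fraction S x y} {T : K} {p p' : T ⟶ x} {q q' : T ⟶ y} {a : T ⟶ F.apex}
    {b : T ⟶ G.apex} (r : F.apex ⟶ G.apex) (hl : r ≫ G.left = F.left)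
    (hr : F.right = r ≫ G.right) (P : F.Pt a p q) (Q : G.Pt b p' q') (θ : p ⟶ p') :
    (Hom.renaming r hl (eqToHom hr)).eval P Q θ = (push P r hl hr).move Q θ := by
  have hmove : ∀ {T : K} {p p' : T ⟶ x} {q q' : T ⟶ y} {a a' : T ⟶ F.apex} (P : F.Pt a p q)
      (Q : F.Pt a' p' q') (θ : p ⟶ p'), P.move Q θ = (push P r hl hr).move (push Q r hl hr) θ := by
    intro T p p' q q' a a' P Q θ
    obtain ⟨s, hs⟩ := Pt.exists_lift P Q θ
    rw [Pt.move_eq s hs, Pt.move_eq (s ▷ r)]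
    · have h1 := whiskerRight_congr hr s
      rw [h1]
      simp
    · have h1 := whiskerRight_congr hl s
      rw [hs, whiskerRight_comp] at h1
      refine (cancel_epi (eqToHom (Strict.assoc _ _ _).symm)).1
        ((cancel_mono (eqToHom (Strict.assoc _ _ _))).1 ?_)
      simp at h1
      simp [h1]
  let τ : Fam F G := ⟨fun T a b p p' q q' P Q θ ↦ (push P r hl hr).move Q θ, by
    intro R T k a b p p' q q' P Q θ
    rw [Pt.res_move, Pt.move_congr _ (push (P.res k) r hl hr) _ (Q.res k)
      (Strict.assoc _ _ _).symm rfl]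
    simp, by
    intros
    rw [hmove]
    simp⟩
  have : Hom.renaming r hl (eqToHom hr) = ofFam τ := by
    ext
    simp [Hom.renaming, ofFam, τ, Pt.move]
  rw [this, eval_ofFam]

end Hom

section Structure

variable {x₁ x₂ x₃ x₄ : K}

/-- The canonical arrow `(u ×_{x₂} v) ×_{x₃} w ⟶ u ×_{x₂} (v ×_{x₃} w)`. -/
noncomputable def assocArrow (F : Fraction S x₁ x₂) (G : Fraction S x₂ x₃) (H : Fraction S x₃ x₄) :
    ((F.comp G).comp H).apex ⟶ (F.comp (G.comp H)).apex :=
  let A := S.pullback G.left G.left_mem F.right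
  let A' := S.pullback H.left H.left_mem (A.snd ≫ G.right)
  let B := S.pullback H.left H.left_mem G.right
  let B' := S.pullback (B.fst ≫ G.left) (G.comp H).left_mem F.right
  B'.lift (A'.fst ≫ A.fst)
    (B.lift (A'.fst ≫ A.snd) A'.snd (by rw [Strict.assoc, A'.w]))
    (by rw [← Strict.assoc _ B.fst, B.lift_fst, Strict.assoc, A.w, Strict.assoc])

/-- The canonical arrow `u ×_{x₂} (v ×_{x₃} w) ⟶ (u ×_{x₂} v) ×_{x₃} w`. -/
noncomputable def assocInvArrow (F : Fraction S x₁ x₂) (G : Fraction S x₂ x₃)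
    (H : Fraction S x₃ x₄) :
    (F.comp (G.comp H)).apex ⟶ ((F.comp G).comp H).apex :=
  let A := S.pullback G.left G.left_mem F.right
  let A' := S.pullback H.left H.left_mem (A.snd ≫ G.right)
  let B := S.pullback H.left H.left_mem G.right
  let B' := S.pullback (B.fst ≫ G.left) (G.comp H).left_mem F.right
  A'.lift (A.lift B'.fst (B'.snd ≫ B.fst) (by rw [B'.w, Strict.assoc])) (B'.snd ≫ B.snd)
    (by rw [← Strict.assoc _ A.snd, A.lift_snd, Strict.assoc, B.w, Strict.assoc])

variable (F : Fraction S x₁ x₂) (G : Fraction S x₂ x₃) (H : Fraction S x₃ x₄)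

theorem assocArrow_left :
    assocArrow F G H ≫ (F.comp (G.comp H)).left = ((F.comp G).comp H).left := by
  simp [assocArrow]

theorem assocArrow_right :
    ((F.comp G).comp H).right = assocArrow F G H ≫ (F.comp (G.comp H)).right := by
  simp [assocArrow]

theorem assocInvArrow_left :
    assocInvArrow F G H ≫ ((F.comp G).comp H).left = (F.comp (G.comp H)).left := by
  simp [assocInvArrow]

theorem assocInvArrow_right :
    (F.comp (G.comp H)).right = assocInvArrow F G H ≫ ((F.comp G).comp H).right := by
  simp [assocInvArrow]

/-- The identity fraction. -/
@[reducible]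
def idFraction (S : StrictTwoSite K) (x : K) : Fraction S x x := ofArrow S (𝟙 x)

/-- The associator: the renaming map given by the canonical isomorphism of iterated pullbacks. -/
noncomputable def Hom.assoc : Hom ((F.comp G).comp H) (F.comp (G.comp H)) :=
  Hom.renaming (assocArrow F G H) (assocArrow_left F G H) (eqToHom (assocArrow_right F G H))

/-- The inverse associator. -/
noncomputable def Hom.assocInv : Hom (F.comp (G.comp H)) ((F.comp G).comp H) :=
  Hom.renaming (assocInvArrow F G H) (assocInvArrow_left F G H)
    (eqToHom (assocInvArrow_right F G H))

theorem leftUnit_left : (S.pullback F.left F.left_mem (𝟙 x₁)).snd ≫ F.left =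
    ((idFraction S x₁).comp F).left := (S.pullback F.left F.left_mem (𝟙 x₁)).w.symm

theorem leftUnitInv_left : (S.pullback F.left F.left_mem (𝟙 x₁)).lift F.left (𝟙 _)
    (by rw [Strict.comp_id, Strict.id_comp]) ≫ ((idFraction S x₁).comp F).left = F.left := by
  simp

theorem leftUnitInv_right : F.right = (S.pullback F.left F.left_mem (𝟙 x₁)).lift F.left (𝟙 _)
    (by rw [Strict.comp_id, Strict.id_comp]) ≫ ((idFraction S x₁).comp F).right := by
  simp

theorem rightUnit_right : (F.comp (idFraction S x₂)).right =
    (S.pullback (𝟙 x₂) (S.id_mem x₂) F.right).fst ≫ F.right :=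
  (S.pullback (𝟙 x₂) (S.id_mem x₂) F.right).w.symm

theorem rightUnitInv_left : (S.pullback (𝟙 x₂) (S.id_mem x₂) F.right).lift (𝟙 _) F.right
    (by rw [Strict.comp_id, Strict.id_comp]) ≫ (F.comp (idFraction S x₂)).left = F.left := by
  simp

theorem rightUnitInv_right : F.right =
    (S.pullback (𝟙 x₂) (S.id_mem x₂) F.right).lift (𝟙 _) F.right
    (by rw [Strict.comp_id, Strict.id_comp]) ≫ (F.comp (idFraction S x₂)).right := by
  simp

/-- The left unitor: the renaming map given by the projection `x ×ₓ u ⟶ u`. -/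
noncomputable def Hom.leftUnit : Hom ((idFraction S x₁).comp F) F :=
  Hom.renaming _ (leftUnit_left F) (eqToHom rfl)

/-- The inverse left unitor. -/
noncomputable def Hom.leftUnitInv : Hom F ((idFraction S x₁).comp F) :=
  Hom.renaming _ (leftUnitInv_left F) (eqToHom (leftUnitInv_right F))

/-- The right unitor: the renaming map given by the projection `u ×_y y ⟶ u`. -/
noncomputable def Hom.rightUnit : Hom (F.comp (idFraction S x₂)) F :=
  Hom.renaming _ rfl (eqToHom (rightUnit_right F))

/-- The inverse right unitor. -/
noncomputable def Hom.rightUnitInv : Hom F (F.comp (idFraction S x₂)) :=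
  Hom.renaming _ (rightUnitInv_left F) (eqToHom (rightUnitInv_right F))

namespace Hom

section

variable {F G H} {T : K} {p p' : T ⟶ x₁} {q q' : T ⟶ x₄}

theorem eval_assoc {c : T ⟶ ((F.comp G).comp H).apex} {d : T ⟶ (F.comp (G.comp H)).apex}
    (C : ((F.comp G).comp H).Pt c p q) (D : (F.comp (G.comp H)).Pt d p' q') (θ : p ⟶ p') :
    (Hom.assoc F G H).eval C D θ = C.r.move D.r.r (C.l.r.move D.r.l (C.l.l.move D.l θ)) := by
  rw [Hom.assoc, eval_renaming, Pt.move_comp, Pt.move_comp,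
    Pt.move_congr (Pt.l (push C _ (assocArrow_left F G H) (assocArrow_right F G H))) C.l.l D.l D.l (by simp [assocArrow]) rfl,
    Pt.move_congr (Pt.l (Pt.r (push C _ (assocArrow_left F G H) (assocArrow_right F G H)))) C.l.r D.r.l D.r.l (by simp [assocArrow]) rfl,
    Pt.move_congr (Pt.r (Pt.r (push C _ (assocArrow_left F G H) (assocArrow_right F G H)))) C.r D.r.r D.r.r (by simp [assocArrow]) rfl]
  simp

theorem eval_assocInv {c : T ⟶ ((F.comp G).comp H).apex} {d : T ⟶ (F.comp (G.comp H)).apex}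
    (D : (F.comp (G.comp H)).Pt d p q) (C : ((F.comp G).comp H).Pt c p' q') (θ : p ⟶ p') :
    (Hom.assocInv F G H).eval D C θ = D.r.r.move C.r (D.r.l.move C.l.r (D.l.move C.l.l θ)) := by
  rw [Hom.assocInv, eval_renaming, Pt.move_comp, Pt.move_comp,
    Pt.move_congr (Pt.l (Pt.l (push D _ (assocInvArrow_left F G H) (assocInvArrow_right F G H)))) D.l C.l.l C.l.l (by simp [assocInvArrow]) rfl,
    Pt.move_congr (Pt.r (Pt.l (push D _ (assocInvArrow_left F G H) (assocInvArrow_right F G H)))) D.r.l C.l.r C.l.r (by simp [assocInvArrow]) rfl,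
    Pt.move_congr (Pt.r (push D _ (assocInvArrow_left F G H) (assocInvArrow_right F G H))) D.r.r C.r C.r (by simp [assocInvArrow]) rfl]
  simp

end

theorem move_idFraction {T : K} {a a' : T ⟶ (idFraction S x).apex} {p q p' q' : T ⟶ x}
    (P : (idFraction S x).Pt a p q)
    (Q : (idFraction S x).Pt a' p' q') (θ : p ⟶ p') :
    P.move Q θ = eqToHom (P.ho.symm.trans P.hb) ≫ θ ≫ eqToHom (Q.hb.symm.trans Q.ho) := by
  obtain ⟨h1, rfl⟩ := P
  obtain ⟨h2, rfl⟩ := Q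
  obtain ⟨s, hs⟩ := Pt.exists_lift (F := idFraction S x) ⟨h1, rfl⟩ ⟨h2, rfl⟩ θ
  rw [Pt.move_eq s hs]
  exact (by simp [hs])

section

variable {F} {T : K} {p p' : T ⟶ x₁} {q q' : T ⟶ x₂}

theorem eval_leftUnit {c : T ⟶ ((idFraction S x₁).comp F).apex} {d : T ⟶ F.apex}
    (C : ((idFraction S x₁).comp F).Pt c p q) (D : F.Pt d p' q') (θ : p ⟶ p') :
    (Hom.leftUnit F).eval C D θ = C.r.move D (eqToHom C.l.hb ≫ θ) := by
  rw [Hom.leftUnit, eval_renaming, Pt.move_congr _ C.r D D rfl rfl]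
  simp

theorem eval_leftUnitInv {c : T ⟶ ((idFraction S x₁).comp F).apex} {d : T ⟶ F.apex}
    (D : F.Pt d p q) (C : ((idFraction S x₁).comp F).Pt c p' q') (θ : p ⟶ p') :
    (Hom.leftUnitInv F).eval D C θ = D.move C.r (θ ≫ eqToHom C.l.hb.symm) := by
  rw [Hom.leftUnitInv, eval_renaming, Pt.move_comp, move_idFraction]
  refine (Pt.move_congr (Pt.r (F := idFraction S x₁) (G := F)
    (push D _ (leftUnitInv_left F) (leftUnitInv_right F))) D C.r C.r
    (by simp) rfl _).trans ?_
  simp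

theorem eval_rightUnit {c : T ⟶ (F.comp (idFraction S x₂)).apex} {d : T ⟶ F.apex}
    (C : (F.comp (idFraction S x₂)).Pt c p q) (D : F.Pt d p' q') (θ : p ⟶ p') :
    (Hom.rightUnit F).eval C D θ = eqToHom (C.r.ho.symm.trans C.r.hb) ≫ C.l.move D θ := by
  rw [Hom.rightUnit, eval_renaming, Pt.move_congr _ C.l D D rfl rfl]
  simp

theorem eval_rightUnitInv {c : T ⟶ (F.comp (idFraction S x₂)).apex} {d : T ⟶ F.apex}
    (D : F.Pt d p q) (C : (F.comp (idFraction S x₂)).Pt c p' q') (θ : p ⟶ p') :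
    (Hom.rightUnitInv F).eval D C θ = D.move C.l θ ≫ eqToHom (C.r.hb.symm.trans C.r.ho) := by
  rw [Hom.rightUnitInv, eval_renaming, Pt.move_comp, move_idFraction]
  have := Pt.move_congr (Pt.l (F := F) (G := idFraction S x₂)
    (push D _ (rightUnitInv_left F) (rightUnitInv_right F))) D C.l C.l
    (by simp) rfl θ
  refine (congrArg (_ ≫ · ≫ _) this).trans ?_
  simp

end

end Hom


namespace Hom

section

variable {y z : K} {F G H I : Fraction S x y} {T : K} {p p' : T ⟶ x} {q q' q'' : T ⟶ y}

theorem eval_comp_left (t : Hom F G) (s : Hom G H) {a : T ⟶ F.apex} {m : T ⟶ G.apex}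
    {b : T ⟶ H.apex} (P : F.Pt a p q) (M : G.Pt m p q') (Q : H.Pt b p' q'') (θ : p ⟶ p') :
    (t.comp s).eval P Q θ = t.eval P M (𝟙 p) ≫ s.eval M Q θ := by
  rw [← eval_comp, Category.id_comp]

theorem eval_comp_right (t : Hom F G) (s : Hom G H) {a : T ⟶ F.apex} {m : T ⟶ G.apex}
    {b : T ⟶ H.apex} (P : F.Pt a p q) (M : G.Pt m p' q') (Q : H.Pt b p' q'') (θ : p ⟶ p') :
    (t.comp s).eval P Q θ = t.eval P M θ ≫ s.eval M Q (𝟙 p') := by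
  rw [← eval_comp, Category.comp_id]

theorem ext_eval₃ {z z' z'' : K} (X : Fraction S x z) (Y : Fraction S x z') (Z : Fraction S x z'')
    {t t' : Hom F G}
    (h : ∀ ⦃T : K⦄ ⦃a : T ⟶ F.apex⦄ ⦃b : T ⟶ G.apex⦄ ⦃m : T ⟶ X.apex⦄ ⦃n : T ⟶ Y.apex⦄
    ⦃k : T ⟶ Z.apex⦄ ⦃p p' : T ⟶ x⦄ ⦃q q' : T ⟶ y⦄ ⦃s : T ⟶ z⦄ ⦃s' : T ⟶ z'⦄ ⦃s'' : T ⟶ z''⦄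
    (P : F.Pt a p q) (Q : G.Pt b p' q') (_ : X.Pt m p s) (_ : Y.Pt n p s') (_ : Z.Pt k p s'')
    (θ : p ⟶ p'), t.eval P Q θ = t'.eval P Q θ) : t = t' := by
  apply ext_eval₂ X Y
  intro T a b m n p p' q q' s s' P Q M N θ
  apply local_ext Z p
  intro R c k hk
  rw [res_eval, res_eval]
  exact h _ _ (M.res c) (N.res c) hk _

theorem id_comp (t : Hom F G) : (Hom.id F).comp t = t := by
  apply ext_eval
  intro T a b p p' q q' P Q θ
  rw [eval_comp_left _ _ P P, eval_id, Pt.move_id, Category.id_comp]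

theorem comp_id (t : Hom F G) : t.comp (Hom.id G) = t := by
  apply ext_eval
  intro T a b p p' q q' P Q θ
  rw [eval_comp_right _ _ P Q, eval_id, Pt.move_id, Category.comp_id]

theorem comp_assoc (t : Hom F G) (s : Hom G H) (r : Hom H I) :
    (t.comp s).comp r = t.comp (s.comp r) := by
  apply ext_eval₂ G H
  intro T a b m n p p' q q' k k' P Q M N θ
  rw [eval_comp_left _ _ P N, eval_comp_left _ _ P M, eval_comp_left _ _ P M,
    eval_comp_left _ _ M N, Category.assoc]

end

variable {x₁ x₂ x₃ x₄ x₅ : K}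

theorem whiskerLeft_id (F : Fraction S x₁ x₂) (G : Fraction S x₂ x₃) :
    (Hom.id G).whiskerLeft F = Hom.id (F.comp G) := by
  apply ext_eval
  intro T a b p p' q q' C D θ
  rw [eval_whiskerLeft, eval_id, eval_id, Pt.move_comp]

theorem whiskerLeft_comp (F : Fraction S x₁ x₂) {G H I : Fraction S x₂ x₃} (t : Hom G H)
    (s : Hom H I) : (t.comp s).whiskerLeft F = (t.whiskerLeft F).comp (s.whiskerLeft F) := by
  apply ext_eval₁ (F.comp H)
  intro T a b m p p' q q' k C D M θ
  rw [eval_comp_left _ _ C M, eval_whiskerLeft, eval_whiskerLeft, eval_whiskerLeft,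
    ← eval_comp]
  simp

theorem id_whiskerLeft {F G : Fraction S x₁ x₂} (t : Hom F G) :
    t.whiskerLeft (idFraction S x₁) =
      (Hom.leftUnit F).comp (t.comp (Hom.leftUnitInv G)) := by
  apply ext_eval
  intro T a b p p' q q' C D θ
  have e : θ = eqToHom C.l.hb.symm ≫ eqToHom C.l.hb ≫ θ := by simp
  have e' : eqToHom C.l.hb ≫ θ = (eqToHom C.l.hb ≫ θ ≫ eqToHom D.l.hb.symm) ≫ eqToHom D.l.hb := by
    simp
  rw [eval_whiskerLeft, move_idFraction]
  conv_rhs => rw [e, eval_comp _ _ C C.r, e', eval_comp _ _ C.r D.r]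
  rw [eval_leftUnit, eval_leftUnitInv]
  simp

theorem comp_whiskerLeft (F : Fraction S x₁ x₂) (G : Fraction S x₂ x₃) {H H' : Fraction S x₃ x₄}
    (t : Hom H H') : t.whiskerLeft (F.comp G) =
      (Hom.assoc F G H).comp (((t.whiskerLeft G).whiskerLeft F).comp (Hom.assocInv F G H')) := by
  apply ext_eval₂ (F.comp (G.comp H)) (F.comp (G.comp H'))
  intro T a b m n p p' q q' s s' C D M N θ
  rw [eval_comp_left _ _ C M, eval_comp_left _ _ M N]
  simp [eval_whiskerLeft, eval_assoc, eval_assocInv, Pt.move_comp]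

theorem id_whiskerRight (F : Fraction S x₁ x₂) (G : Fraction S x₂ x₃) :
    (Hom.id F).whiskerRight G = Hom.id (F.comp G) := by
  apply ext_eval
  intro T a b p p' q q' C D θ
  rw [eval_whiskerRight, eval_id, eval_id, Pt.move_comp]

theorem comp_whiskerRight {F G H : Fraction S x₁ x₂} (t : Hom F G) (s : Hom G H)
    (I : Fraction S x₂ x₃) :
    (t.comp s).whiskerRight I = (t.whiskerRight I).comp (s.whiskerRight I) := by
  apply ext_eval₁ (G.comp I)
  intro T a b m p p' q q' k C D M θ
  rw [eval_comp_left _ _ C M, eval_whiskerRight, eval_whiskerRight, eval_whiskerRight,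
    eval_comp_left _ _ C.l M.l]
  simp

theorem whiskerRight_id {F G : Fraction S x₁ x₂} (t : Hom F G) :
    t.whiskerRight (idFraction S x₂) =
      (Hom.rightUnit F).comp (t.comp (Hom.rightUnitInv G)) := by
  apply ext_eval
  intro T a b p p' q q' C D θ
  rw [eval_whiskerRight, move_idFraction, eval_comp_left _ _ C C.l, eval_comp_right _ _ C.l D.l,
    eval_rightUnit, eval_rightUnitInv]
  simp

theorem whiskerRight_comp {F F' : Fraction S x₁ x₂} (t : Hom F F') (G : Fraction S x₂ x₃)
    (H : Fraction S x₃ x₄) : t.whiskerRight (G.comp H) =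
      (Hom.assocInv F G H).comp (((t.whiskerRight G).whiskerRight H).comp (Hom.assoc F' G H)) := by
  apply ext_eval₂ ((F.comp G).comp H) ((F'.comp G).comp H)
  intro T a b m n p p' q q' s s' C D M N θ
  rw [eval_comp_left _ _ C M, eval_comp_left _ _ M N]
  simp [eval_whiskerRight, eval_assoc, eval_assocInv, Pt.move_comp]

theorem whisker_assoc (F : Fraction S x₁ x₂) {G G' : Fraction S x₂ x₃} (t : Hom G G')
    (H : Fraction S x₃ x₄) : (t.whiskerLeft F).whiskerRight H =
      (Hom.assoc F G H).comp (((t.whiskerRight H).whiskerLeft F).comp (Hom.assocInv F G' H)) := by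
  apply ext_eval₂ (F.comp (G.comp H)) (F.comp (G'.comp H))
  intro T a b m n p p' q q' s s' C D M N θ
  rw [eval_comp_left _ _ C M, eval_comp_left _ _ M N]
  simp [eval_whiskerRight, eval_whiskerLeft, eval_assoc, eval_assocInv]

theorem whisker_exchange {F G : Fraction S x₁ x₂} {H I : Fraction S x₂ x₃} (t : Hom F G)
    (s : Hom H I) : (s.whiskerLeft F).comp (t.whiskerRight I) =
      (t.whiskerRight H).comp (s.whiskerLeft G) := by
  apply ext_eval₂ (F.comp I) (G.comp H)
  intro T a b m n p p' q q' k k' C D M N θ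
  rw [eval_comp_left _ _ C M, eval_comp_left _ _ C N]
  simp [eval_whiskerRight, eval_whiskerLeft]

theorem pentagon (F : Fraction S x₁ x₂) (G : Fraction S x₂ x₃) (H : Fraction S x₃ x₄)
    (I : Fraction S x₄ x₅) :
    ((Hom.assoc F G H).whiskerRight I).comp
      ((Hom.assoc F (G.comp H) I).comp ((Hom.assoc G H I).whiskerLeft F)) =
    (Hom.assoc (F.comp G) H I).comp (Hom.assoc F G (H.comp I)) := by
  apply ext_eval₃ ((F.comp (G.comp H)).comp I) (F.comp ((G.comp H).comp I))
    ((F.comp G).comp (H.comp I))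
  intro T a b m n k p p' q q' s s' s'' C D M N L θ
  rw [eval_comp_left _ _ C M, eval_comp_left _ _ M N, eval_comp_left _ _ C L]
  simp only [eval_whiskerRight, eval_whiskerLeft, eval_assoc, Pt.move_comp, Pt.move_move,
    Category.id_comp]

theorem triangle (F : Fraction S x₁ x₂) (G : Fraction S x₂ x₃) :
    (Hom.assoc F (idFraction S x₂) G).comp ((Hom.leftUnit G).whiskerLeft F) =
      (Hom.rightUnit F).whiskerRight G := by
  apply ext_eval₁ (F.comp ((idFraction S x₂).comp G))
  intro T a b m p p' q q' s C D M θ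
  rw [eval_comp_left _ _ C M]
  simp [eval_whiskerRight, eval_whiskerLeft, eval_assoc, eval_leftUnit, eval_rightUnit,
    move_idFraction]

theorem assoc_inv (F : Fraction S x₁ x₂) (G : Fraction S x₂ x₃) (H : Fraction S x₃ x₄) :
    (Hom.assoc F G H).comp (Hom.assocInv F G H) = Hom.id _ := by
  apply ext_eval₁ (F.comp (G.comp H))
  intro T a b m p p' q q' s C D M θ
  rw [eval_comp_left _ _ C M]
  simp [eval_assoc, eval_assocInv, eval_id, Pt.move_comp]

theorem inv_assoc (F : Fraction S x₁ x₂) (G : Fraction S x₂ x₃) (H : Fraction S x₃ x₄) :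
    (Hom.assocInv F G H).comp (Hom.assoc F G H) = Hom.id _ := by
  apply ext_eval₁ ((F.comp G).comp H)
  intro T a b m p p' q q' s C D M θ
  rw [eval_comp_left _ _ C M]
  simp [eval_assoc, eval_assocInv, eval_id, Pt.move_comp]

theorem leftUnit_inv (F : Fraction S x₁ x₂) :
    (Hom.leftUnit F).comp (Hom.leftUnitInv F) = Hom.id _ := by
  apply ext_eval₁ F
  intro T a b m p p' q q' s C D M θ
  rw [eval_comp_left _ _ C M]
  simp [eval_leftUnit, eval_leftUnitInv, eval_id, Pt.move_comp, move_idFraction]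

theorem inv_leftUnit (F : Fraction S x₁ x₂) :
    (Hom.leftUnitInv F).comp (Hom.leftUnit F) = Hom.id _ := by
  apply ext_eval₁ ((idFraction S x₁).comp F)
  intro T a b m p p' q q' s C D M θ
  rw [eval_comp_left _ _ C M]
  simp [eval_leftUnit, eval_leftUnitInv, eval_id]

theorem rightUnit_inv (F : Fraction S x₁ x₂) :
    (Hom.rightUnit F).comp (Hom.rightUnitInv F) = Hom.id _ := by
  apply ext_eval₁ F
  intro T a b m p p' q q' s C D M θ
  rw [eval_comp_left _ _ C M]
  simp [eval_rightUnit, eval_rightUnitInv, eval_id, Pt.move_comp, move_idFraction]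

theorem inv_rightUnit (F : Fraction S x₁ x₂) :
    (Hom.rightUnitInv F).comp (Hom.rightUnit F) = Hom.id _ := by
  apply ext_eval₁ (F.comp (idFraction S x₂))
  intro T a b m p p' q q' s C D M θ
  rw [eval_comp_left _ _ C M]
  simp [eval_rightUnit, eval_rightUnitInv, eval_id]

end Hom

end Structure

end Fraction

end Calculus

section FractionBicategory

variable {K : Type u} [Bicategory.{w, v} K] [Bicategory.Strict K] {S : StrictTwoSite K}

/-- The bicategory of fractions `K_J`: its objects are those of `K`. -/
structure FractionBicat (S : StrictTwoSite K) where
  /-- the underlying object -/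
  obj : K

noncomputable instance fractionCategory (x y : K) : Category.{w} (Fraction S x y) where
  Hom F G := Fraction.Hom F G
  id F := Fraction.Hom.id F
  comp t s := t.comp s
  id_comp := Fraction.Hom.id_comp
  comp_id := Fraction.Hom.comp_id
  assoc := Fraction.Hom.comp_assoc

/-- The bicategory structure on `K_J`: 1-arrows are fractions, 2-arrows are maps of fractions. -/
noncomputable instance fractionBicategory : Bicategory.{w, max u v} (FractionBicat S) where
  Hom X Y := Fraction S X.obj Y.obj
  id X := Fraction.ofArrow S (𝟙 X.obj)
  comp F G := Fraction.comp F G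
  homCategory X Y := fractionCategory X.obj Y.obj
  whiskerLeft F _ _ t := Fraction.Hom.whiskerLeft F t
  whiskerRight t H := Fraction.Hom.whiskerRight t H
  associator F G H := ⟨Fraction.Hom.assoc F G H, Fraction.Hom.assocInv F G H,
    Fraction.Hom.assoc_inv F G H, Fraction.Hom.inv_assoc F G H⟩
  leftUnitor F := ⟨Fraction.Hom.leftUnit F, Fraction.Hom.leftUnitInv F,
    Fraction.Hom.leftUnit_inv F, Fraction.Hom.inv_leftUnit F⟩
  rightUnitor F := ⟨Fraction.Hom.rightUnit F, Fraction.Hom.rightUnitInv F,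
    Fraction.Hom.rightUnit_inv F, Fraction.Hom.inv_rightUnit F⟩
  whiskerLeft_id := Fraction.Hom.whiskerLeft_id
  whiskerLeft_comp F _ _ _ t s := Fraction.Hom.whiskerLeft_comp F t s
  id_whiskerLeft := Fraction.Hom.id_whiskerLeft
  comp_whiskerLeft F G _ _ t := Fraction.Hom.comp_whiskerLeft F G t
  id_whiskerRight := Fraction.Hom.id_whiskerRight
  comp_whiskerRight := Fraction.Hom.comp_whiskerRight
  whiskerRight_id := Fraction.Hom.whiskerRight_id
  whiskerRight_comp := Fraction.Hom.whiskerRight_comp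
  whisker_assoc F _ _ t H := Fraction.Hom.whisker_assoc F t H
  whisker_exchange := Fraction.Hom.whisker_exchange
  pentagon := Fraction.Hom.pentagon
  triangle := Fraction.Hom.triangle

/-- The map of fractions given by a 2-arrow `a` of `K`: it is `a` whiskered with the projection
`x ×ₓ x ⟶ x`. -/
def ofTwoArrow (S : StrictTwoSite K) {x y : K} {f g : x ⟶ y} (a : f ⟶ g) :
    Fraction.Hom (Fraction.ofArrow S f) (Fraction.ofArrow S g) where
  cell :=
    let W : StrictPullback (𝟙 x) (𝟙 x) :=
      (Fraction.ofArrow S f).overlap (Fraction.ofArrow S g)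
    W.fst ◁ a ≫ eqToHom (by rw [← Strict.comp_id W.fst, W.w, Strict.comp_id])

/-- The data of the assignment `A_J : K ⟶ K_J` on objects, 1-arrows and 2-arrows. -/
def inclusionData (S : StrictTwoSite K) : PrelaxFunctorStruct K (FractionBicat S) where
  obj x := ⟨x⟩
  map f := Fraction.ofArrow S f
  map₂ a := ofTwoArrow S a

end FractionBicategory

end TwoSite

/-! A map of fractions `t` is determined by its values `t.eval P Q θ`, where `P` and `Q` are
generalised elements of the two fractions, lying over arrows `p`, `p'` into the common source, and
`θ : p ⟶ p'` (`ext_eval`). For the fraction of a 1-arrow `f` the left leg is an identity, so an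
element over `p` is just `p` itself, its image in the target is `p ≫ f`, and moving along `θ` is
whiskering, `θ ▷ f` (`move_ofArrow`). The map of fractions given by `α : f ⟶ g` takes the value `θ ▷
f ≫ p' ◁ α` (`eval_ofTwoArrow`). Up to `eqToHom`, every identity required of a strict 2-functor
thereby becomes an identity in the strict 2-category `K`: compatibility with vertical composition
and with both whiskerings is the interchange law, and compatibility with associators and unitors
says that whiskering `θ` by several arrows in turn is whiskering it by their composite.

On 1-arrows strictness is the normalisation of the specified pullbacks: a pullback of an identity is
an identity, so the composite of the fractions of `f` and `g` is literally the fraction of `f ≫ g`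
(`ofArrow_comp`). The comparison 2-arrows are then `eqToHom`s of equalities of fractions, and by
`exists_eval_eqToHom` such a 2-arrow acts on elements by a move. A move in the fraction of a 1-arrow
depends only on `θ` and on the images of the elements, so there is no need to know which element the
equality produces.

Local full faithfulness is descent. For two fractions with left leg `𝟙 x`, the projections of the
overlap `x ×ₓ x` coincide, so a map of fractions is a 2-arrow `fst ≫ f ⟶ fst ≫ g`; since `fst` is a
cover, it descends uniquely to `f ⟶ g` (`ofTwoArrow_bijective`). -/

namespace TwoSite

variable {K : Type u} [Bicategory.{w, v} K] [Bicategory.Strict K] {S : StrictTwoSite K}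

namespace Fraction

/-! ### Elements and values for the fractions of 1-arrows. -/

section OfArrow

attribute [local simp] Strict.associator_eqToIso Strict.leftUnitor_eqToIso
  Strict.rightUnitor_eqToIso

variable {x y z : K} {f g : x ⟶ y} {T R : K} {p p' : T ⟶ x} {q q' : T ⟶ y}

/-- Elements of the fraction of a 1-arrow are determined by their image in the source. -/
theorem Pt.map_eq {a : T ⟶ (ofArrow S f).apex} (P : (ofArrow S f).Pt a p q) : p ≫ f = q := by
  rw [← P.hb, ← P.ho, Strict.comp_id]

/-- The left leg is an identity, so lifting `θ` through it returns `θ` up to `eqToHom`. The right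
side involves `a` and `a'` only through their images, which makes the choice of elements irrelevant
in the later comparisons. -/
theorem move_ofArrow {a a' : T ⟶ (ofArrow S f).apex} (P : (ofArrow S f).Pt a p q)
    (Q : (ofArrow S f).Pt a' p' q') (θ : p ⟶ p') :
    P.move Q θ = eqToHom P.map_eq.symm ≫ θ ▷ f ≫ eqToHom Q.map_eq := by
  obtain ⟨rfl, rfl⟩ := P
  obtain ⟨rfl, rfl⟩ := Q
  obtain ⟨s, hs⟩ := Pt.exists_lift (F := ofArrow S f) ⟨rfl, rfl⟩ ⟨rfl, rfl⟩ θ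
  rw [Pt.move_eq s hs]
  obtain rfl : θ = s ▷ 𝟙 x := by simpa using hs.symm
  simp

namespace Hom

/-- The proposed values form a natural family: naturality in `θ` is the interchange law. A map of
fractions is recovered from its value at the two tautological elements of the overlap, so it is
enough to compare there. -/
theorem eval_ofTwoArrow (α : f ⟶ g) {a : T ⟶ (ofArrow S f).apex} {b : T ⟶ (ofArrow S g).apex}
    (P : (ofArrow S f).Pt a p q) (Q : (ofArrow S g).Pt b p' q') (θ : p ⟶ p') :
    (ofTwoArrow S α).eval P Q θ =
      eqToHom P.map_eq.symm ≫ θ ▷ f ≫ p' ◁ α ≫ eqToHom Q.map_eq := by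
  let τ : Fam (ofArrow S f) (ofArrow S g) :=
    ⟨fun T a b p p' q q' P Q θ ↦ eqToHom P.map_eq.symm ≫ θ ▷ f ≫ p' ◁ α ≫ eqToHom Q.map_eq, by
      intros; simp, by
      intros
      simp [move_ofArrow, whisker_exchange_assoc]⟩
  have : ofTwoArrow S α = ofFam τ := by
    ext
    simp only [ofTwoArrow, ofFam, τ]
    -- The tautological element lies over `fst ≫ 𝟙 x`, whereas `ofTwoArrow` whiskers with `fst`.
    -- These are equal but not definitionally so, and `h'` carries the whiskering across the
    -- equality.
    have h : ((ofArrow S f).overlap (ofArrow S g)).fst =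
        ((ofArrow S f).overlap (ofArrow S g)).fst ≫ (ofArrow S f).left :=
      (Strict.comp_id _).symm
    have h' : ∀ {c d : ((ofArrow S f).overlap (ofArrow S g)).pt ⟶ x} (e : c = d),
        c ◁ α = eqToHom (by rw [e]) ≫ d ◁ α ≫ eqToHom (by rw [e]) := by
      rintro c _ rfl
      simp
    rw [h' h]
    simp
  rw [this, eval_ofFam]

/-- An equality of fractions acts on elements through some element of the target. -/
theorem exists_eval_eqToHom {F G : Fraction S x y} (h : F = G) {a : T ⟶ F.apex}
    (P : F.Pt a p q) : ∃ (a' : T ⟶ G.apex) (P' : G.Pt a' p q), ∀ {b : T ⟶ G.apex}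
      {p' : T ⟶ x} {q' : T ⟶ y} (Q : G.Pt b p' q') (θ : p ⟶ p'),
      Hom.eval (eqToHom h : F ⟶ G) P Q θ = P'.move Q θ := by
  -- For general `h` the witness is `a` transported along the equality of vertices; once `h` is
  -- substituted it is `a` itself, and an identity map of fractions acts by moves.
  subst h
  exact ⟨a, P, fun Q θ ↦ eval_id P Q θ⟩

end Hom

/-! ### Strictness on composite 1-arrows. -/

/-- This is where the condition that the specified pullback of an identity be an identity enters:
the composite span has vertex `x`, left leg `𝟙 x ≫ 𝟙 x` and right leg `f ≫ g`. -/
theorem ofArrow_comp (S : StrictTwoSite K) (f : x ⟶ y) (g : y ⟶ z) :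
    ofArrow S (f ≫ g) = (ofArrow S f).comp (ofArrow S g) := by
  -- The types of the legs depend on the vertex of the pullback, so the pullback and the membership
  -- proof are generalised to variables and the equation with `ofId f` is substituted as a whole.
  have h : ∀ (P : StrictPullback (𝟙 y) f) (hP : S.mem (P.fst ≫ 𝟙 x)),
      P = StrictPullback.ofId f → ofArrow S (f ≫ g) = ⟨P.pt, P.fst ≫ 𝟙 x, hP, P.snd ≫ g⟩ := by
    rintro _ _ rfl
    simp only [StrictPullback.ofId, Strict.comp_id]
  exact h _ _ (S.pullback_id f)

/-! ### Strict compatibility with the operations on 2-arrows. -/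

namespace Hom

variable {x₁ x₂ x₃ x₄ : K}

theorem ofTwoArrow_id (f : x ⟶ y) : ofTwoArrow S (𝟙 f) = Hom.id (ofArrow S f) := by
  apply ext_eval
  intro T a b p p' q q' P Q θ
  rw [eval_ofTwoArrow, eval_id, move_ofArrow]
  simp

/-- The associators and unitors of the strict 2-category `K` are `eqToHom`s; this identifies their
images in the bicategory of fractions. -/
theorem ofTwoArrow_eqToHom {f g : x ⟶ y} (h : f = g) :
    ofTwoArrow S (eqToHom h) = (eqToHom (congrArg (ofArrow S) h) : ofArrow S f ⟶ ofArrow S g) := by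
  subst h
  exact ofTwoArrow_id f

/-- On values, interchange moves `θ` past `α`. -/
theorem ofTwoArrow_comp {f g h : x ⟶ y} (α : f ⟶ g) (β : g ⟶ h) :
    ofTwoArrow S (α ≫ β) = (ofTwoArrow S α).comp (ofTwoArrow S β) := by
  apply ext_eval
  intro T a b p p' q q' P Q θ
  -- The left leg of the middle fraction is an identity, so `p` itself is an element over `p` and no
  -- passage to a cover is needed.
  obtain ⟨m, M⟩ : ∃ m, (ofArrow S g).Pt m p (p ≫ g) := ⟨p, Strict.comp_id p, rfl⟩
  rw [eval_comp_left _ _ P M, eval_ofTwoArrow, eval_ofTwoArrow, eval_ofTwoArrow]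
  simp [Bicategory.whisker_exchange_assoc]

/-- Naturality square of the comparison `eqToHom`s. Evaluated on elements, its two sides are the two
sides of the interchange law for `θ` and `f ◁ α`. -/
theorem ofTwoArrow_whiskerLeft (f : x₁ ⟶ x₂) {g g' : x₂ ⟶ x₃} (α : g ⟶ g') :
    (ofTwoArrow S (f ◁ α)).comp (eqToHom (ofArrow_comp S f g')) =
      Hom.comp (eqToHom (ofArrow_comp S f g)) ((ofTwoArrow S α).whiskerLeft (ofArrow S f)) := by
  -- Each vertical composite is evaluated through an element of its middle fraction; these two
  -- fractions supply `M` and `N`.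
  apply ext_eval₂ (ofArrow S (f ≫ g')) ((ofArrow S f).comp (ofArrow S g))
  intro T a b m n p p' q q' s s' P Q M N θ
  obtain ⟨m', M', hM⟩ := exists_eval_eqToHom (ofArrow_comp S f g') M
  obtain ⟨a', P', hP⟩ := exists_eval_eqToHom (ofArrow_comp S f g) P
  rw [eval_comp_left _ _ P M, eval_comp_left _ _ P N, hM, hP, eval_whiskerLeft, Pt.move_comp,
    Pt.move_comp]
  have e := congrArg (eqToHom P.map_eq.symm ≫ · ≫ eqToHom ((Strict.assoc _ _ _).symm.trans
    ((congrArg (· ≫ g') Q.l.map_eq).trans Q.r.map_eq))) (Bicategory.whisker_exchange θ (f ◁ α))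
  -- On the right side `α` is whiskered with the image in `x₂` of the first component of `Q`, which
  -- equals `p' ≫ f` only up to the equation `Q.l.map_eq`.
  have h : ∀ {c d : T ⟶ x₂} (e : c = d),
      c ◁ α = eqToHom (by rw [e]) ≫ d ◁ α ≫ eqToHom (by rw [e]) := by
    rintro c _ rfl
    simp
  simp only [eval_ofTwoArrow, move_ofArrow, h Q.l.map_eq.symm]
  simpa using e

/-- As for left whiskering, with the interchange law for `θ` and `α ▷ g`. -/
theorem ofTwoArrow_whiskerRight {f f' : x₁ ⟶ x₂} (α : f ⟶ f') (g : x₂ ⟶ x₃) :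
    (ofTwoArrow S (α ▷ g)).comp (eqToHom (ofArrow_comp S f' g)) =
      Hom.comp (eqToHom (ofArrow_comp S f g)) ((ofTwoArrow S α).whiskerRight (ofArrow S g)) := by
  apply ext_eval₂ (ofArrow S (f' ≫ g)) ((ofArrow S f).comp (ofArrow S g))
  intro T a b m n p p' q q' s s' P Q M N θ
  obtain ⟨m', M', hM⟩ := exists_eval_eqToHom (ofArrow_comp S f' g) M
  obtain ⟨a', P', hP⟩ := exists_eval_eqToHom (ofArrow_comp S f g) P
  rw [eval_comp_left _ _ P M, eval_comp_left _ _ P N, hM, hP, eval_whiskerRight, Pt.move_comp,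
    Pt.move_comp]
  have e := congrArg (eqToHom P.map_eq.symm ≫ · ≫ eqToHom ((Strict.assoc _ _ _).symm.trans
    ((congrArg (· ≫ g) Q.l.map_eq).trans Q.r.map_eq))) (Bicategory.whisker_exchange θ (α ▷ g))
  simp only [eval_ofTwoArrow, move_ofArrow]
  simpa using e

/-- Both 2-arrows act on elements by moves along `θ`, up to `eqToHom`, in the fraction of `f`, hence
both take the value `θ ▷ f`. -/
theorem leftUnit_ofArrow (f : x ⟶ y)
    (h : (idFraction S x).comp (ofArrow S f) = ofArrow S f) :
    Hom.leftUnit (ofArrow S f) = eqToHom h := by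
  apply ext_eval
  intro T a b p p' q q' P Q θ
  obtain ⟨a', P', hP⟩ := exists_eval_eqToHom h P
  rw [hP, eval_leftUnit]
  simp [move_ofArrow]

theorem rightUnit_ofArrow (f : x ⟶ y)
    (h : (ofArrow S f).comp (idFraction S y) = ofArrow S f) :
    Hom.rightUnit (ofArrow S f) = eqToHom h := by
  apply ext_eval
  intro T a b p p' q q' P Q θ
  obtain ⟨a', P', hP⟩ := exists_eval_eqToHom h P
  rw [hP, eval_rightUnit]
  simp [move_ofArrow]

/-- Both sides act by three successive moves, in the fractions of `f`, `g` and `k`. Through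
different elements these give the same iterated whiskering of `θ`, by `move_ofArrow`. -/
theorem assoc_ofArrow (f : x₁ ⟶ x₂) (g : x₂ ⟶ x₃) (k : x₃ ⟶ x₄)
    (h : ((ofArrow S f).comp (ofArrow S g)).comp (ofArrow S k) =
      (ofArrow S f).comp ((ofArrow S g).comp (ofArrow S k))) :
    Hom.assoc (ofArrow S f) (ofArrow S g) (ofArrow S k) = eqToHom h := by
  apply ext_eval
  intro T a b p p' q q' P Q θ
  obtain ⟨a', P', hP⟩ := exists_eval_eqToHom h P
  rw [hP, eval_assoc, Pt.move_comp, Pt.move_comp]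
  simp [move_ofArrow]

/-! ### Local full faithfulness. -/

/-- The assignment `a ↦ ofTwoArrow S a` is a bijection on 2-arrows. -/
theorem ofTwoArrow_bijective (f g : x ⟶ y) :
    Function.Bijective fun a : f ⟶ g ↦ ofTwoArrow S a := by
  have hW : S.mem ((ofArrow S f).overlap (ofArrow S g)).fst := S.pullback_mem _ _ _
  -- The pullback square has identities on its two other sides, so its projections agree and the
  -- cell of a map of fractions can be read as a 2-arrow `fst ≫ f ⟶ fst ≫ g`.
  have e : ((ofArrow S f).overlap (ofArrow S g)).snd = ((ofArrow S f).overlap (ofArrow S g)).fst :=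
    (Strict.comp_id _).symm.trans
      (((ofArrow S f).overlap (ofArrow S g)).w.symm.trans (Strict.comp_id _))
  constructor
  · intro a b h
    have h' := congrArg Hom.cell h
    simp only [ofTwoArrow, cancel_mono] at h'
    exact StrictTwoSite.cover_ext hW h'
  · intro t
    -- The preimage of `t` is the descent of its cell along the cover `fst`.
    refine ⟨S.desc hW (t.cell ≫ eqToHom (congrArg (· ≫ g) e)), ?_⟩
    ext
    simp [ofTwoArrow, StrictTwoSite.whisker_desc]

end Hom

end OfArrow

end Fraction

/-! ### Assembly of the strict 2-functor. -/

/-- The strict 2-functor `A_J : K ⟶ K_J`. -/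
noncomputable def inclusion (S : StrictTwoSite K) : StrictPseudofunctor K (FractionBicat S) :=
  StrictPseudofunctor.mk'
    { inclusionData S with
      map₂_id := Fraction.Hom.ofTwoArrow_id
      map₂_comp := Fraction.Hom.ofTwoArrow_comp
      map_id := fun _ ↦ rfl
      map_comp := Fraction.ofArrow_comp S
      map₂_whisker_left := by
        intro a b c f g g' α
        -- The field expresses the image of a whiskering as a conjugate by comparison 2-arrows;
        -- moving the right-hand comparison across gives the naturality square already proved.
        rw [← Category.assoc, eq_comm, comp_eqToHom_iff]
        exact (Fraction.Hom.ofTwoArrow_whiskerLeft (S := S) f α).symm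
      map₂_whisker_right := by
        intro a b c f f' α g
        rw [← Category.assoc, eq_comm, comp_eqToHom_iff]
        exact (Fraction.Hom.ofTwoArrow_whiskerRight (S := S) α g).symm
      map₂_left_unitor := by
        intro a b f
        have h := Fraction.Hom.leftUnit_ofArrow (S := S) f
          ((Fraction.ofArrow_comp S (𝟙 a) f).symm.trans (by rw [Strict.id_comp]))
        rw [Strict.leftUnitor_eqToIso]
        -- Both sides are now composites of `eqToHom`s between the same two fractions. The right
        -- unitor and the associator are treated alike.
        exact (Fraction.Hom.ofTwoArrow_eqToHom (Strict.id_comp f)).trans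
          ((eqToHom_trans _ _).symm.trans (congrArg (_ ≫ ·) h.symm))
      map₂_right_unitor := by
        intro a b f
        have h := Fraction.Hom.rightUnit_ofArrow (S := S) f
          ((Fraction.ofArrow_comp S f (𝟙 b)).symm.trans (by rw [Strict.comp_id]))
        rw [Strict.rightUnitor_eqToIso]
        exact (Fraction.Hom.ofTwoArrow_eqToHom (Strict.comp_id f)).trans
          ((eqToHom_trans _ _).symm.trans (congrArg (_ ≫ ·) h.symm))
      map₂_associator := by
        intro a b c d f g k
        have h := Fraction.Hom.assoc_ofArrow (S := S) f g k
          (by simp only [← Fraction.ofArrow_comp, Strict.assoc])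
        rw [Strict.associator_eqToIso]
        refine (Fraction.Hom.ofTwoArrow_eqToHom (Strict.assoc f g k)).trans (Eq.trans ?_
          (congrArg (fun t ↦ _ ≫ t ≫ _) h.symm))
        exact ((congrArg (_ ≫ ·) (eqToHom_trans _ _)).trans (eqToHom_trans _ _)).symm }

end TwoSite

theorem mainTheorem4 {K : Type u} [Bicategory.{w, v} K] [Bicategory.Strict K]
    (S : TwoSite.StrictTwoSite K) :
    ∃ A : StrictPseudofunctor K (TwoSite.FractionBicat S),
      A.toPrelaxFunctorStruct = TwoSite.inclusionData S ∧
        ∀ x y : K, (A.mapFunctor x y).Full ∧ (A.mapFunctor x y).Faithful :=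
  -- `inclusion` extends `inclusionData`, so the underlying data agree definitionally. Surjectivity
  -- and injectivity of `ofTwoArrow` are fullness and faithfulness.
  ⟨TwoSite.inclusion S, rfl, fun _ _ ↦
    ⟨⟨(TwoSite.Fraction.Hom.ofTwoArrow_bijective _ _).2⟩,
      ⟨fun h ↦ (TwoSite.Fraction.Hom.ofTwoArrow_bijective _ _).1 h⟩⟩⟩
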